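/- **Setting.** Let $n\ge 0$ and let $J=J^1(\mathbb R^n)\cong\mathbb R^{2n+1}$ have coordinates $z=(x^i,u,p_i)$ and contact form $\alpha=du-p_i\,dx^i$. For a smooth $H:J\to\mathbb R$ let $$X_H=\frac{\partial H}{\partial p_i}\frac{\partial}{\partial x^i}-\Big(\frac{\partial H}{\partial x^i}+p_i\frac{\partial H}{\partial u}\Big)\frac{\partial}{\partial p_i}+\Big(p_i\frac{\partial H}{\partial p_i}-H\Big)\frac{\partial}{\partial u}$$ be its contact Hamiltonian vector field and $\Phi_H^t$ the (maximal, possibly only partially defined) flow of $X_H$. The contact-Jacobi bracket is $$[H,K]=\sum_i\Big(\frac{\partial H}{\partial p_i}\frac{\partial K}{\partial x^i}-\frac{\partial H}{\partial x^i}\frac{\partial K}{\partial p_i}\Big)+\frac{\partial H}{\partial u}\Big(K-p_i\frac{\partial K}{\partial p_i}\Big)-\frac{\partial K}{\partial u}\Big(H-p_i\frac{\partial H}{\partial p_i}\Big).$$ A smooth function $H$ on $J$ is *strict* if $\partial H/\partial u=0$, and *prolonged* if $H(x,u,p)=f(x,u)+g^i(x,u)p_i$ with $f,g^i$ smooth.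 **Proposition.** Let $I$ be a finite set, let $s_0$ and $s_i$ ($i\in I$) be strict, let $d_0$ and $d_i$ ($i\in I$) be prolonged, and put $$H^{(N)}=s_0+d_0+\sum_{i\in I}[s_i,d_i].$$ Let $U\subset J$ be compact. Then for every $k\in\mathbb N$ there are finitely many generators $g_1,\dots,g_m\in\{s_0,d_0\}\cup\{s_i,d_i:i\in I\}$ and times $\tau_1(h),\dots,\tau_m(h)$, each of the form $\tau_j(h)=c_j|h|$ or $\tau_j(h)=c_j|h|^{1/2}$ with a real coefficient $c_j$ that depends on $h$ only through its sign, such that the composition of exact flows $$\Psi_{N,h}=\Phi_{g_m}^{\tau_m(h)}\circ\dots\circ\Phi_{g_1}^{\tau_1(h)}$$ has the following properties. 1. There are an open set $V\supset U$ and $h_0>0$ such that, for all $|h|<h_0$, the successive flows composing $\Psi_{N,h}$ and the flow $\Phi^h_{H^{(N)}}$ are defined at every point of $V$, $\Phi^h_{H^{(N)}}$ is smooth on $V$, and $\Psi_{N,h}$ is a contactomorphism from $V$ onto the open set $\Psi_{N,h}(V)$, i.e. a smooth diffeomorphism with $\Psi_{N,h}^*\alpha=e^{\lambda}\alpha$ for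 some function $\lambda$ on $V$. 2. For every finite $r$, $$\Psi_{N,h}=\Phi_{H^{(N)}}^h+O(h^{k+1})\quad\text{in }C^r(U)\text{ as }h\to0,$$ that is, there is a constant $C$ with $\max_{j\le r}\sup_{z\in U}\|D^j(\Psi_{N,h}-\Phi^h_{H^{(N)}})(z)\|\le C|h|^{k+1}$ for all sufficiently small $|h|$. -/

import Mathlib

open scoped ContDiff

namespace ContactSplitting

noncomputable section

/-- The jet space `J¹(ℝⁿ) ≅ ℝ²ⁿ⁺¹` in its global Darboux coordinates `z = (x, u, p)`. -/
abbrev Jet (n : ℕ) : Type := (Fin n → ℝ) × ℝ × (Fin n → ℝ)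

variable {n : ℕ}

/-- The partial derivative `∂H/∂xⁱ`. -/
def dx (H : Jet n → ℝ) (i : Fin n) (z : Jet n) : ℝ := fderiv ℝ H z (Pi.single i 1, 0, 0)

/-- The partial derivative `∂H/∂u`. -/
def du (H : Jet n → ℝ) (z : Jet n) : ℝ := fderiv ℝ H z (0, 1, 0)

/-- The partial derivative `∂H/∂pᵢ`. -/
def dp (H : Jet n → ℝ) (i : Fin n) (z : Jet n) : ℝ := fderiv ℝ H z (0, 0, Pi.single i 1)

/-- The contact form `α = du - pᵢ dxⁱ` at `z`, evaluated on the tangent vector `v`. -/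
def contactForm (z v : Jet n) : ℝ := v.2.1 - ∑ i, z.2.2 i * v.1 i

/-- The contact Hamiltonian vector field
`X_H = H_{pᵢ} ∂_{xⁱ} + (pᵢ H_{pᵢ} - H) ∂_u - (H_{xⁱ} + pᵢ H_u) ∂_{pᵢ}`. -/
def contactField (H : Jet n → ℝ) (z : Jet n) : Jet n :=
  (fun i => dp H i z,
    (∑ i, z.2.2 i * dp H i z) - H z,
    fun i => -(dx H i z + z.2.2 i * du H z))

/-- The Poisson bracket `{H, K} = H_{pᵢ} K_{xⁱ} - H_{xⁱ} K_{pᵢ}`. -/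
def poisson (H K : Jet n → ℝ) (z : Jet n) : ℝ :=
  ∑ i, (dp H i z * dx K i z - dx H i z * dp K i z)

/-- The Euler operator `E[H] = H - pᵢ H_{pᵢ}`. -/
def euler (H : Jet n → ℝ) (z : Jet n) : ℝ := H z - ∑ i, z.2.2 i * dp H i z

/-- The contact-Jacobi bracket `[H, K] = {H, K} + H_u E[K] - K_u E[H]`. -/
def jacobi (H K : Jet n → ℝ) (z : Jet n) : ℝ :=
  poisson H K z + du H z * euler K z - du K z * euler H z

/-- Strict contact Hamiltonians: smooth and independent of `u`. -/
def IsStrict (H : Jet n → ℝ) : Prop := ContDiff ℝ ∞ H ∧ ∀ z, du H z = 0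

/-- Prolonged Hamiltonians: smooth and affine in `p`, i.e. `H(x,u,p) = f(x,u) + gⁱ(x,u) pᵢ`. -/
def IsProlonged (H : Jet n → ℝ) : Prop :=
  ContDiff ℝ ∞ H ∧
    ∃ (f : (Fin n → ℝ) × ℝ → ℝ) (g : Fin n → (Fin n → ℝ) × ℝ → ℝ),
      ContDiff ℝ ∞ f ∧ (∀ i, ContDiff ℝ ∞ (g i)) ∧
        ∀ x u p, H (x, u, p) = f (x, u) + ∑ i, g i (x, u) * p i

/-- `γ` solves `γ' = X(γ)`, `γ(0) = z` on the closed interval between `0` and `t`. -/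
def Solves (X : Jet n → Jet n) (z : Jet n) (t : ℝ) (γ : ℝ → Jet n) : Prop :=
  γ 0 = z ∧ IsIntegralCurveOn γ (fun _ => X) (Set.uIcc 0 t)

/-- The exact flow of `X` through `z` exists up to the (positive or negative) time `t`. -/
def FlowDefined (X : Jet n → Jet n) (t : ℝ) (z : Jet n) : Prop := ∃ γ, Solves X z t γ

open Classical in
/-- The exact (maximal) flow of `X`: the value at time `t` of the solution starting at `z`.
For the smooth fields considered here the solution is unique. The value is meaningful
only where `FlowDefined X t z` holds. -/
def flow (X : Jet n → Jet n) (t : ℝ) (z : Jet n) : Jet n :=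
  if h : FlowDefined X t z then h.choose t else z

/-- The exact contact flow `Φ_H^t`. -/
def contactFlow (H : Jet n → ℝ) (t : ℝ) (z : Jet n) : Jet n := flow (contactField H) t z

/-- The point `z` lies in the domain of `Φ_H^t`. -/
def ContactFlowDefined (H : Jet n → ℝ) (t : ℝ) (z : Jet n) : Prop :=
  FlowDefined (contactField H) t z

/-- One factor `Φ_H^τ` of a splitting method. Its time `τ` is a fixed coefficient times
`|h|`, or times `√|h|` as in commutator gadgets; the coefficient is `cPos` for step sizes
`h ≥ 0` and `cNeg` for `h < 0`. -/
structure Factor (n : ℕ) where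
  ham : Jet n → ℝ
  sqrtScaled : Bool
  cPos : ℝ
  cNeg : ℝ

/-- The time for which the factor is run when the step size is `h`. -/
def Factor.time (F : Factor n) (h : ℝ) : ℝ :=
  (if 0 ≤ h then F.cPos else F.cNeg) * (if F.sqrtScaled then √|h| else |h|)

/-- The composition of the exact flows of the factors; the head of the list acts first. -/
def splittingMap : List (Factor n) → ℝ → Jet n → Jet n
  | [], _, z => z
  | F :: w, h, z => splittingMap w h (contactFlow F.ham (F.time h) z)

/-- Every exact flow in the composition exists at the point at which it is evaluated. -/
def SplittingDefined : List (Factor n) → ℝ → Jet n → Prop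
  | [], _, _ => True
  | F :: w, h, z =>
      ContactFlowDefined F.ham (F.time h) z ∧
        SplittingDefined w h (contactFlow F.ham (F.time h) z)

/-- `ψ` restricts to a contactomorphism from the open set `V` onto the open set `ψ(V)`:
a smooth diffeomorphism with `ψ^*α = e^ℓ α` on `V` for some function `ℓ`. -/
def IsContactomorphismOn (ψ : Jet n → Jet n) (V : Set (Jet n)) : Prop :=
  IsOpen V ∧ IsOpen (ψ '' V) ∧ ContDiffOn ℝ ∞ ψ V ∧
    (∃ χ : Jet n → Jet n, ContDiffOn ℝ ∞ χ (ψ '' V) ∧ Set.LeftInvOn χ ψ V) ∧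
      ∃ ℓ : Jet n → ℝ, ∀ z ∈ V, ∀ v : Jet n,
        contactForm (ψ z) (fderiv ℝ ψ z v) = Real.exp (ℓ z) * contactForm z v

/-- `‖f‖_{C^r(U)} ≤ B`: all derivatives of `f` of order at most `r` are bounded by `B` on `U`. -/
def CrNormLE (r : ℕ) (U : Set (Jet n)) (f : Jet n → Jet n) (B : ℝ) : Prop :=
  ∀ j ≤ r, ∀ z ∈ U, ‖iteratedFDeriv ℝ j f z‖ ≤ B

end

end ContactSplitting

/-! Put `h = τ²`. A factor then runs for a time polynomial in `τ`, and a composition of exact flows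
becomes a family of maps jointly smooth in `(τ, z)` near `τ = 0`. Families are compared modulo `τ ^
p` times a smooth family (`CongrMod`). Because the remainder is itself smooth in all variables, one
congruence controls every spatial derivative on compact sets (`CongrMod.exists_bound`).

Leading order: `H ↦ X_H` carries the Jacobi bracket to the Lie bracket of fields
(`contactField_jacobi`), and the group commutator of two flows run for time `τ` is the identity plus
`τ²` times a Lie bracket, modulo `τ³` (`commutator_expansion`). Each summand of the Hamiltonian thus
has a word equal to `z + τ² X(z)` modulo `τ³`; concatenation adds the fields, and the result agrees
with the exact flow at time `τ²` modulo `τ³`.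

Higher order (`exists_word_succ`): if `Ψ_τ = Φ^{τ²} + τ^p e` modulo `τ^{p+1}`, then `Ψ_{bτ}⁻¹ ∘
Ψ_{aτ} ∘ Ψ_{aτ}` has total time `(2a² - b²)τ²` and leading error `(2a^p - b^p) τ^p e`. For `p ≥ 3`
one can have `2a² - b² = 1` and `2a^p = b^p`, which gains one power of `τ`; iteration reaches any
order. Negative steps use the inverse word, and the sign-dependent coefficients switch off whichever
half is not wanted.

Smoothness of flows comes from `differenceField`, a smooth field whose integral curves carry
difference quotients of integral curves of `X` and, in the limit, solutions of the variational
equation. The contact form paired with such a solution satisfies a scalar linear equation, whence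
the conformal factor. -/

noncomputable section

open scoped ContDiff Topology
open Set Metric

universe u

/-! ### Hadamard's lemma with parameters. -/

/-- Hadamard's integral formula for the difference quotient of a `C¹` function at `0`. -/
theorem dslope_zero_eq_integral {E : Type*} [NormedAddCommGroup E] [NormedSpace ℝ E]
    [CompleteSpace E] {f : ℝ → E} (hf : ContDiff ℝ 1 f) (τ : ℝ) :
    dslope f 0 τ = ∫ s in (0 : ℝ)..1, deriv f (s * τ) := by
  rcases eq_or_ne τ 0 with rfl | hτ
  · simp
  · rw [dslope_of_ne _ hτ, slope_def_module, intervalIntegral.integral_comp_mul_right _ hτ]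
    have := intervalIntegral.integral_deriv_eq_sub' (a := 0) (b := τ) f rfl
      (fun x _ => hf.differentiable (by simp) x) (hf.continuous_deriv (by simp)).continuousOn
    simp [this]

section Hadamard

-- A common universe lets the induction on the order replace `E` by `P →L[ℝ] E`.
variable {P E : Type u} [NormedAddCommGroup P] [NormedSpace ℝ P] [FiniteDimensional ℝ P]
  [NormedAddCommGroup E] [NormedSpace ℝ E] [CompleteSpace E]

/-- Integration over the unit interval of a jointly `C^m` family yields a `C^m` function. -/
theorem contDiff_unitInterval_integral (m : ℕ) {h : P → ℝ → E}
    (hh : ContDiff ℝ m (Function.uncurry h)) :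
    ContDiff ℝ m (fun p => ∫ s in (0 : ℝ)..1, h p s) := by
  induction m generalizing E with
  | zero =>
    exact contDiff_zero.2 (intervalIntegral.continuous_parametric_intervalIntegral_of_continuous'
      hh.continuous 0 1)
  | succ m ih =>
    push_cast at hh ⊢
    have hF : ContDiff ℝ m (Function.uncurry fun p s => fderiv ℝ (fun q => h q s) p) := by
      have h1 : ContDiff ℝ ((m : WithTop ℕ∞) + 1)
          (Function.uncurry fun (y : P × ℝ) (q : P) => h q y.2) :=
        hh.comp (g := Function.uncurry h)
          (f := fun y : (P × ℝ) × P => (y.2, y.1.2)) (by fun_prop)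
      exact ContDiff.fderiv h1 (contDiff_fst) le_rfl
    refine contDiff_succ_iff_hasFDerivAt.2
      ⟨fun p => ∫ s in (0 : ℝ)..1, fderiv ℝ (fun q => h q s) p, ih hF, fun p => ?_⟩
    have hdiff : ∀ s, Differentiable ℝ fun q => h q s := fun s =>
      (hh.comp (g := Function.uncurry h) (f := fun q : P => (q, s)) (by fun_prop)).differentiable
        (by simp)
    have hcont : ∀ p, Continuous (h p) := fun p =>
      hh.continuous.comp (by fun_prop : Continuous fun s : ℝ => (p, s))
    have hcont' : ∀ p, Continuous fun s => fderiv ℝ (fun q => h q s) p := fun p =>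
      hF.continuous.comp (by fun_prop : Continuous fun s : ℝ => (p, s))
    obtain ⟨C, hC⟩ := ((isCompact_closedBall p 1).prod
      (isCompact_Icc (a := (0 : ℝ)) (b := 1))).exists_bound_of_continuousOn hF.continuous.continuousOn
    refine intervalIntegral.hasFDerivAt_integral_of_dominated_of_fderiv_le (bound := fun _ => C)
      (F := h) (F' := fun p s => fderiv ℝ (fun q => h q s) p)
      (closedBall_mem_nhds p one_pos) ?_ ((hcont p).intervalIntegrable _ _)
      (hcont' p).aestronglyMeasurable ?_ intervalIntegrable_const ?_
    · exact .of_forall fun q => (hcont q).aestronglyMeasurable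
    · refine .of_forall fun s hs q hq => hC (q, s) ⟨hq, ?_⟩
      rw [uIoc_of_le zero_le_one] at hs
      exact Ioc_subset_Icc_self hs
    · exact .of_forall fun s _ q _ => (hdiff s q).hasFDerivAt

/-- The integrand in Hadamard's formula is `∂f/∂τ`, so one order of differentiability is lost; this
is harmless for smooth `f`. -/
theorem contDiff_dslope_zero_nat (m : ℕ) {f : ℝ × P → E} (hf : ContDiff ℝ (m + 1 : ℕ) f) :
    ContDiff ℝ m (fun y : ℝ × P => dslope (fun τ => f (τ, y.2)) 0 y.1) := by
  have hslice : ∀ p, ContDiff ℝ (m + 1 : ℕ) fun τ : ℝ => f (τ, p) := fun p =>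
    hf.comp (f := fun τ : ℝ => (τ, p)) (by fun_prop)
  have hderiv : ∀ y : ℝ × P, ∀ τ, deriv (fun τ => f (τ, y.2)) τ = fderiv ℝ f (τ, y.2) (1, 0) := by
    intro y τ
    have h1 : HasDerivAt (fun τ : ℝ => (τ, y.2)) ((1 : ℝ), (0 : P)) τ :=
      (hasDerivAt_id τ).prodMk (hasDerivAt_const τ y.2)
    exact (((hf.differentiable (by simp)) (τ, y.2)).hasFDerivAt.comp_hasDerivAt τ h1).deriv
  have hint : (fun y : ℝ × P => dslope (fun τ => f (τ, y.2)) 0 y.1) =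
      fun y => ∫ s in (0 : ℝ)..1, fderiv ℝ f (s * y.1, y.2) (1, 0) := by
    funext y
    rw [dslope_zero_eq_integral ((hslice y.2).of_le (by simp))]
    simp only [hderiv]
  rw [hint]
  refine contDiff_unitInterval_integral m ?_
  have hfd : ContDiff ℝ m (fderiv ℝ f) := hf.fderiv_right (by simp)
  exact (hfd.comp (f := fun q : (ℝ × P) × ℝ => (q.2 * q.1.1, q.1.2)) (by fun_prop)).clm_apply
    contDiff_const

/-- The difference quotient at `0` of a smooth family is smooth in all variables. -/
theorem contDiff_dslope_zero {f : ℝ × P → E} (hf : ContDiff ℝ ∞ f) :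
    ContDiff ℝ ∞ (fun y : ℝ × P => dslope (fun τ => f (τ, y.2)) 0 y.1) :=
  contDiff_infty.2 fun m => contDiff_dslope_zero_nat m (contDiff_infty.1 hf (m + 1))

/-- Local form of `contDiff_dslope_zero` (Hadamard's lemma with parameters). -/
theorem ContDiffAt.dslope_zero {f : ℝ × P → E} {p : P} (hf : ContDiffAt ℝ ∞ f (0, p)) :
    ContDiffAt ℝ ∞ (fun y : ℝ × P => dslope (fun τ => f (τ, y.2)) 0 y.1) (0, p) := by
  -- Smoothness at a point supplies a neighbourhood that depends on the order, so the cutoff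
  -- reducing to the global statement is chosen separately for each `m`.
  refine contDiffAt_infty.2 fun m => ?_
  have hf' := contDiffAt_infty.1 hf (m + 1)
  have hev : ∀ᶠ y in 𝓝 ((0 : ℝ), p), ContDiffAt ℝ (m + 1 : ℕ) f y :=
    hf'.eventually (by simp)
  obtain ⟨ε, hε, hball⟩ := Metric.eventually_nhds_iff_ball.1 hev
  let χ : ContDiffBump ((0 : ℝ), p) := ⟨ε / 3, ε / 2, by positivity, by linarith⟩
  have hg : ContDiff ℝ (m + 1 : ℕ) fun y => χ y • f y := by
    refine contDiff_iff_contDiffAt.2 fun y => ?_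
    by_cases hy' : y ∈ tsupport χ
    swap
    · refine contDiffAt_const (c := (0 : E)) |>.congr_of_eventuallyEq ?_
      filter_upwards [notMem_tsupport_iff_eventuallyEq.1 hy'] with q hq
      simp [hq]
    rw [χ.tsupport_eq] at hy'
    exact χ.contDiff.contDiffAt.smul
      (hball y (closedBall_subset_ball (by simp only [χ]; linarith) hy'))
  refine (contDiff_dslope_zero_nat m hg).contDiffAt.congr_of_eventuallyEq ?_
  have heq : ∀ y ∈ ball ((0 : ℝ), p) (ε / 3), χ y • f y = f y := fun y hy => by
    rw [χ.one_of_mem_closedBall (ball_subset_closedBall hy), one_smul]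
  filter_upwards [ball_mem_nhds ((0 : ℝ), p) (by positivity : 0 < ε / 3)] with y hy
  have hmem : ∀ τ, |τ| < ε / 3 → (τ, y.2) ∈ ball ((0 : ℝ), p) (ε / 3) := fun τ hτ => by
    rw [← ball_prod_same] at hy ⊢
    exact ⟨by simpa using hτ, hy.2⟩
  have hloc : (fun τ => χ (τ, y.2) • f (τ, y.2)) =ᶠ[𝓝 0] fun τ => f (τ, y.2) := by
    filter_upwards [ball_mem_nhds (0 : ℝ) (by positivity : 0 < ε / 3)] with τ hτ
    exact heq _ (hmem τ (by simpa using hτ))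
  rcases eq_or_ne y.1 0 with h0 | h0
  · rw [h0, dslope_same, dslope_same, hloc.deriv_eq]
  · rw [dslope_of_ne _ h0, dslope_of_ne _ h0, slope_def_module, slope_def_module, hloc.eq_of_nhds,
      heq y hy]

end Hadamard

/-! ### Time-one maps: uniqueness, open domain, continuity. -/

namespace TimeOne

variable {E : Type u} [NormedAddCommGroup E] [NormedSpace ℝ E]

/-- `γ` is an integral curve of `X` over the unit interval that starts at `z`. -/
def IsCurve (X : E → E) (z : E) (γ : ℝ → E) : Prop :=
  γ 0 = z ∧ IsIntegralCurveOn γ (fun _ => X) (Icc 0 1)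

/-- The integral curve of `X` through `z` exists up to time one. -/
def Defined (X : E → E) (z : E) : Prop := ∃ γ, IsCurve X z γ

open Classical in
/-- The time-one map of the vector field `X` (the identity where it is not defined). -/
def map (X : E → E) (z : E) : E := if h : Defined X z then h.choose 1 else z

theorem IsCurve.hasDerivWithinAt_Ici {X : E → E} {z : E} {γ : ℝ → E} (hγ : IsCurve X z γ) :
    ∀ t ∈ Ico (0 : ℝ) 1, HasDerivWithinAt γ (X (γ t)) (Ici t) t := fun t ht =>
  (hγ.2 t (Ico_subset_Icc_self ht)).mono_of_mem_nhdsWithin (Icc_mem_nhdsGE_of_mem ht)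

theorem IsCurve.continuousOn {X : E → E} {z : E} {γ : ℝ → E} (hγ : IsCurve X z γ) :
    ContinuousOn γ (Icc 0 1) := IsIntegralCurveOn.continuousOn hγ.2

theorem IsCurve.exists_norm_lt {X : E → E} {z : E} {γ : ℝ → E} (hγ : IsCurve X z γ) :
    ∃ R > 0, ∀ t ∈ Icc (0 : ℝ) 1, ‖γ t‖ < R := by
  obtain ⟨C, hC⟩ := isCompact_Icc.exists_bound_of_continuousOn hγ.continuousOn
  exact ⟨|C| + 1, by positivity, fun t ht =>
    (hC t ht).trans_lt ((le_abs_self C).trans_lt (lt_add_one _))⟩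

variable [FiniteDimensional ℝ E]

/-- A `C¹` vector field agrees on any ball with a bounded, globally Lipschitz one. -/
theorem exists_bounded_lipschitz_eqOn {X : E → E} (hX : ContDiff ℝ 1 X) (R : ℝ) (hR : 0 < R) :
    ∃ (Y : E → E) (K M : NNReal), LipschitzWith K Y ∧ (∀ x, ‖Y x‖ ≤ M) ∧
      ∀ x, ‖x‖ ≤ R → Y x = X x := by
  let χ : ContDiffBump (0 : E) := ⟨R, R + 1, hR, by linarith⟩
  have hs : HasCompactSupport fun x => χ x • X x := χ.hasCompactSupport.smul_right
  have hc : ContDiff ℝ 1 fun x => χ x • X x := χ.contDiff.smul hX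
  obtain ⟨K, hK⟩ := hc.lipschitzWith_of_hasCompactSupport hs one_ne_zero
  obtain ⟨M, hM⟩ := hs.exists_bound_of_continuous hc.continuous
  refine ⟨_, K, M.toNNReal, hK, fun x => (hM x).trans (Real.le_coe_toNNReal M), fun x hx => ?_⟩
  rw [χ.one_of_mem_closedBall (by simpa using hx), one_smul]

/-- Both curves stay in one ball, on which `X` coincides with a globally Lipschitz field, so
Lipschitz uniqueness applies. -/
theorem IsCurve.eqOn {X : E → E} (hX : ContDiff ℝ 1 X) {z : E} {γ γ' : ℝ → E}
    (hγ : IsCurve X z γ) (hγ' : IsCurve X z γ') : EqOn γ γ' (Icc 0 1) := by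
  obtain ⟨R, hR, h⟩ := hγ.exists_norm_lt
  obtain ⟨R', -, h'⟩ := hγ'.exists_norm_lt
  obtain ⟨Y, K, -, hK, -, hY⟩ := exists_bounded_lipschitz_eqOn hX (max R R') (by positivity)
  have hL : LipschitzOnWith K X (closedBall 0 (max R R')) := by
    intro x hx y hy
    rw [← hY x (by simpa using hx), ← hY y (by simpa using hy)]
    exact hK x y
  refine ODE_solution_unique_of_mem_Icc_right (v := fun _ => X) (K := K)
    (s := fun _ => closedBall 0 (max R R')) (fun _ _ => hL) hγ.continuousOn
    hγ.hasDerivWithinAt_Ici (fun t ht => ?_) hγ'.continuousOn hγ'.hasDerivWithinAt_Ici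
    (fun t ht => ?_) (hγ.1.trans hγ'.1.symm)
  · simpa using Or.inl (h t (Ico_subset_Icc_self ht)).le
  · simpa using Or.inr (h' t (Ico_subset_Icc_self ht)).le

theorem IsCurve.map_eq {X : E → E} (hX : ContDiff ℝ 1 X) {z : E} {γ : ℝ → E}
    (hγ : IsCurve X z γ) : map X z = γ 1 := by
  have h : Defined X z := ⟨γ, hγ⟩
  rw [map, dif_pos h]
  exact h.choose_spec.eqOn hX hγ (right_mem_Icc.2 zero_le_one)

/-- Bounded Lipschitz fields have integral curves over the unit interval. -/
theorem defined_of_lipschitz {Y : E → E} {K M : NNReal} (hK : LipschitzWith K Y)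
    (hM : ∀ x, ‖Y x‖ ≤ M) (x : E) : Defined Y x := by
  have hP : IsPicardLindelof (fun _ : ℝ => Y) (tmin := 0) (tmax := 1)
      ⟨0, left_mem_Icc.2 zero_le_one⟩ x M 0 M K :=
    ⟨fun _ _ => hK.lipschitzOnWith, fun _ _ => continuousOn_const, fun _ _ y _ => hM y, by simp⟩
  exact hP.exists_eq_forall_mem_Icc_hasDerivWithinAt₀

/-- Near a point where the time-one map is defined it is defined, and Lipschitz at that point. -/
theorem eventually_defined {X : E → E} (hX : ContDiff ℝ 1 X) {z : E} (hz : Defined X z) :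
    ∃ C : ℝ, ∀ᶠ x in 𝓝 z, Defined X x ∧ dist (map X x) (map X z) ≤ dist x z * C := by
  obtain ⟨γ, hγ⟩ := hz
  obtain ⟨R, hR, hb⟩ := hγ.exists_norm_lt
  obtain ⟨Y, K, M, hK, hM, hY⟩ := exists_bounded_lipschitz_eqOn hX (R + 1) (by positivity)
  have hγY : IsCurve Y z γ := ⟨hγ.1, fun t ht => by
    simp only
    rw [hY _ (by linarith [hb t ht])]
    exact hγ.2 t ht⟩
  refine ⟨Real.exp K, ?_⟩
  -- By Grönwall the curves of the truncated field `Y` separate by a factor at most `exp K`. This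
  -- radius keeps the new curve within distance `1` of `γ`, hence inside the ball of radius `R + 1`,
  -- where `Y = X`.
  filter_upwards [ball_mem_nhds z (Real.exp_pos (-(K : ℝ)))] with x hx
  obtain ⟨η, hη⟩ := defined_of_lipschitz hK hM x
  have hdist : ∀ t ∈ Icc (0 : ℝ) 1, dist (η t) (γ t) ≤ dist x z * Real.exp K := by
    intro t ht
    refine (dist_le_of_trajectories_ODE (v := fun _ => Y) (fun _ => hK) hη.continuousOn
      hη.hasDerivWithinAt_Ici hγY.continuousOn hγY.hasDerivWithinAt_Ici
      (by rw [hη.1, hγY.1]) t ht).trans ?_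
    have : (K : ℝ) * (t - 0) ≤ K := by
      have := mul_le_mul_of_nonneg_left ht.2 K.2
      simpa using this
    gcongr
  have hlt : dist x z * Real.exp K < 1 := by
    have := mul_lt_mul_of_pos_right (mem_ball.1 hx) (Real.exp_pos (K : ℝ))
    rwa [← Real.exp_add, neg_add_cancel, Real.exp_zero] at this
  have hηX : IsCurve X x η := ⟨hη.1, fun t ht => by
    have h1 : ‖η t‖ ≤ R + 1 := by
      have h2 := norm_le_norm_add_norm_sub' (η t) (γ t)
      rw [← dist_eq_norm] at h2
      linarith [hdist t ht, hb t ht]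
    simp only
    rw [← hY _ h1]
    exact hη.2 t ht⟩
  refine ⟨⟨η, hηX⟩, ?_⟩
  rw [hηX.map_eq hX, hγ.map_eq hX]
  exact hdist 1 (right_mem_Icc.2 zero_le_one)

theorem isOpen_defined {X : E → E} (hX : ContDiff ℝ 1 X) : IsOpen {z | Defined X z} :=
  isOpen_iff_mem_nhds.2 fun _ hz =>
    let ⟨_, hC⟩ := eventually_defined hX hz
    hC.mono fun _ h => h.1

theorem continuousAt_map {X : E → E} (hX : ContDiff ℝ 1 X) {z : E} (hz : Defined X z) :
    ContinuousAt (map X) z := by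
  obtain ⟨C, hC⟩ := eventually_defined hX hz
  refine tendsto_iff_dist_tendsto_zero.2 (squeeze_zero' (.of_forall fun _ => dist_nonneg)
    (hC.mono fun _ h => h.2) ?_)
  have : Filter.Tendsto (fun x => dist x z * C) (𝓝 z) (𝓝 (dist z z * C)) :=
    (by fun_prop : Continuous fun x => dist x z * C).tendsto z
  simpa using this

end TimeOne

/-! ### Differentiability and smoothness of time-one maps. -/

namespace TimeOne

variable {E : Type u} [NormedAddCommGroup E] [NormedSpace ℝ E]

/-- The field on triples `(x, v, ε)` whose integral curves with `ε ≠ 0` are pairs of integral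
curves of `X` together with their difference quotient; at `ε = 0` it is the linearisation of `X`. -/
def differenceField (X : E → E) (q : E × E × ℝ) : E × E × ℝ :=
  (X q.1, dslope (fun e : ℝ => X (q.1 + e • q.2.1)) 0 q.2.2, 0)

/-- `η` solves the variational equation along the integral curve `γ` of `X`. -/
def IsVariation (X : E → E) (γ : ℝ → E) (v : E) (η : ℝ → E) : Prop :=
  η 0 = v ∧ ∀ t ∈ Icc (0 : ℝ) 1, HasDerivWithinAt η (fderiv ℝ X (γ t) (η t)) (Icc 0 1) t

theorem differenceField_zero {X : E → E} (hX : ContDiff ℝ ∞ X) (x v : E) :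
    differenceField X (x, v, 0) = (X x, fderiv ℝ X x v, 0) := by
  have h1 : HasDerivAt (fun e : ℝ => x + e • v) v 0 := by
    simpa using ((hasDerivAt_id (0 : ℝ)).smul_const v).const_add x
  have h2 : HasFDerivAt X (fderiv ℝ X x) (x + (0 : ℝ) • v) := by
    simpa using (hX.differentiable (by simp) x).hasFDerivAt
  have := (h2.comp_hasDerivAt 0 h1).deriv
  simp only [differenceField, dslope_same]
  exact congrArg (fun w => (X x, w, (0 : ℝ))) this

/-- Makes the variational equation, which depends on time through `γ`, part of an autonomous system,
so that results on time-one maps apply to it. -/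
theorem IsCurve.prod_variation {X : E → E} (hX : ContDiff ℝ ∞ X) {x v : E} {γ η : ℝ → E}
    (hγ : IsCurve X x γ) (hη : IsVariation X γ v η) :
    IsCurve (differenceField X) (x, v, 0) (fun t => (γ t, η t, 0)) := by
  refine ⟨by simp [hγ.1, hη.1], fun t ht => ?_⟩
  simp only [differenceField_zero hX]
  exact (hγ.2 t ht).prodMk ((hη.2 t ht).prodMk (hasDerivWithinAt_const t _ _))

theorem IsVariation.add {X : E → E} {γ η η' : ℝ → E} {v v' : E} (h : IsVariation X γ v η)
    (h' : IsVariation X γ v' η') : IsVariation X γ (v + v') (fun t => η t + η' t) :=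
  ⟨by simp [h.1, h'.1], fun t ht => by simpa using (h.2 t ht).fun_add (h'.2 t ht)⟩

theorem IsVariation.smul {X : E → E} {γ η : ℝ → E} {v : E} (h : IsVariation X γ v η) (c : ℝ) :
    IsVariation X γ (c • v) (fun t => c • η t) :=
  ⟨by simp [h.1], fun t ht => by simpa using (h.2 t ht).fun_const_smul c⟩

theorem isVariation_zero (X : E → E) (γ : ℝ → E) : IsVariation X γ 0 (fun _ => 0) :=
  ⟨rfl, fun t _ => by simpa using hasDerivWithinAt_const t _ _⟩

variable [FiniteDimensional ℝ E]

/-- Hadamard's lemma removes the apparent singularity of the difference quotient at `ε = 0`. -/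
theorem contDiff_differenceField {X : E → E} (hX : ContDiff ℝ ∞ X) :
    ContDiff ℝ ∞ (differenceField X) := by
  have h := contDiff_dslope_zero (P := E × E) (f := fun y : ℝ × E × E => X (y.2.1 + y.1 • y.2.2))
    (hX.comp (by fun_prop))
  exact (hX.comp contDiff_fst).prodMk
    ((h.comp (f := fun q : E × E × ℝ => (q.2.2, q.1, q.2.1)) (by fun_prop)).prodMk contDiff_const)

/-- By uniqueness the first component is `γ` and the last stays `0`, which leaves the variational
equation for the middle one. -/
theorem IsCurve.exists_variation_of_defined {X : E → E} (hX : ContDiff ℝ ∞ X) {x v : E}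
    {γ : ℝ → E} (hγ : IsCurve X x γ) (h : Defined (differenceField X) (x, v, 0)) :
    ∃ η, IsVariation X γ v η := by
  obtain ⟨q, hq0, hq⟩ := h
  have h1 : IsCurve X x fun t => (q t).1 :=
    ⟨by simp [hq0], fun t ht => (hq t ht).fst⟩
  have h3 : IsCurve (fun _ : ℝ => (0 : ℝ)) 0 fun t => (q t).2.2 :=
    ⟨by simp [hq0], fun t ht => (hq t ht).snd.snd⟩
  have h3' : IsCurve (fun _ : ℝ => (0 : ℝ)) 0 fun _ => 0 :=
    ⟨rfl, fun t _ => hasDerivWithinAt_const t _ _⟩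
  refine ⟨fun t => (q t).2.1, by simp [hq0], fun t ht => ?_⟩
  have hqt : q t = (γ t, (q t).2.1, 0) :=
    Prod.ext (h1.eqOn (hX.of_le (by simp)) hγ ht)
      (Prod.ext rfl (h3.eqOn contDiff_const h3' ht))
  have := (hq t ht).snd.fst
  simp only at this
  rw [hqt, differenceField_zero hX] at this
  exact this

/-- The variational equation along an integral curve over the unit interval is solvable. -/
theorem IsCurve.exists_variation {X : E → E} (hX : ContDiff ℝ ∞ X) {x : E}
    {γ : ℝ → E} (hγ : IsCurve X x γ) (v : E) : ∃ η, IsVariation X γ v η := by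
  have h0 : Defined (differenceField X) (x, 0, 0) :=
    ⟨_, hγ.prod_variation hX (isVariation_zero X γ)⟩
  have hopen := isOpen_defined ((contDiff_differenceField hX).of_le (m := 1) (by simp))
  -- The zero variation exists and the domain is open, so variations exist for small multiples of
  -- `v`; linearity of the equation scales them back to `v`.
  have hev : ∀ᶠ c : ℝ in 𝓝 0, Defined (differenceField X) (x, c • v, 0) := by
    have hc : Continuous fun c : ℝ => (x, c • v, (0 : ℝ)) := by fun_prop
    exact hc.continuousAt.eventually (hopen.mem_nhds (by simpa using h0))
  obtain ⟨c, hc, hc0⟩ := ((hev.filter_mono nhdsWithin_le_nhds).and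
    (self_mem_nhdsWithin (s := {0}ᶜ))).exists
  obtain ⟨η, hη⟩ := hγ.exists_variation_of_defined hX hc
  exact ⟨_, by simpa [smul_smul, inv_mul_cancel₀ hc0] using hη.smul c⁻¹⟩

theorem IsVariation.map_eq {X : E → E} (hX : ContDiff ℝ ∞ X) {x v : E} {γ η : ℝ → E}
    (hγ : IsCurve X x γ) (hη : IsVariation X γ v η) :
    (map (differenceField X) (x, v, 0)).2.1 = η 1 := by
  rw [(hγ.prod_variation hX hη).map_eq ((contDiff_differenceField hX).of_le (by simp))]

/-- The quotient `(γ' - γ)/ε` of two integral curves is the middle component of a curve of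
`differenceField X`. This reduces differentiability of the time-one map to continuity of another one
at `ε = 0`. -/
theorem map_differenceField_of_ne {X : E → E} (hX : ContDiff ℝ ∞ X) {x v : E} {ε : ℝ}
    (hε : ε ≠ 0) (hx : Defined X x) (hv : Defined X (x + ε • v)) :
    map X (x + ε • v) = map X x + ε • (map (differenceField X) (x, v, ε)).2.1 := by
  obtain ⟨γ, hγ⟩ := hx
  obtain ⟨γ', hγ'⟩ := hv
  have hq : IsCurve (differenceField X) (x, v, ε) fun t => (γ t, ε⁻¹ • (γ' t - γ t), ε) := by
    refine ⟨by simp [hγ.1, hγ'.1, smul_smul, inv_mul_cancel₀ hε], fun t ht => ?_⟩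
    refine (hγ.2 t ht).prodMk (HasDerivWithinAt.prodMk ?_ (hasDerivWithinAt_const t _ _))
    have := ((hγ'.2 t ht).fun_sub (hγ.2 t ht)).fun_const_smul ε⁻¹
    simpa [dslope_of_ne _ hε, slope_def_module, smul_smul, mul_inv_cancel₀ hε] using this
  have hX1 : ContDiff ℝ 1 X := hX.of_le (by simp)
  rw [hq.map_eq ((contDiff_differenceField hX).of_le (by simp)), hγ.map_eq hX1, hγ'.map_eq hX1]
  simp [smul_smul, mul_inv_cancel₀ hε]

/-- The time-one map of a smooth field is differentiable, its derivative being given by the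
variational equation. -/
theorem exists_hasFDerivAt {X : E → E} (hX : ContDiff ℝ ∞ X) {x : E} (hx : Defined X x) :
    ∃ L : E →L[ℝ] E, HasFDerivAt (map X) L x ∧
      ∀ v, L v = (map (differenceField X) (x, v, 0)).2.1 := by
  have hX1 : ContDiff ℝ 1 X := hX.of_le (by simp)
  have hZ1 : ContDiff ℝ 1 (differenceField X) := (contDiff_differenceField hX).of_le (by simp)
  obtain ⟨γ, hγ⟩ := id hx
  choose η hη using hγ.exists_variation hX
  have hmap : ∀ {v η'}, IsVariation X γ v η' → (map (differenceField X) (x, v, 0)).2.1 = η' 1 :=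
    fun h => h.map_eq hX hγ
  have hlin : IsLinearMap ℝ fun v => (map (differenceField X) (x, v, 0)).2.1 :=
    ⟨fun v w => by rw [hmap ((hη v).add (hη w)), hmap (hη v), hmap (hη w)],
      fun c v => by rw [hmap ((hη v).smul c), hmap (hη v)]⟩
  let L : E →L[ℝ] E := LinearMap.toContinuousLinearMap hlin.mk'
  have hL : ∀ v, L v = (map (differenceField X) (x, v, 0)).2.1 := fun v => rfl
  refine ⟨L, ?_, hL⟩
  have hdef : ∀ v, Defined (differenceField X) (x, v, 0) :=
    fun v => ⟨_, hγ.prod_variation hX (hη v)⟩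
  rw [hasFDerivAt_iff_isLittleO_nhds_zero, Asymptotics.isLittleO_iff]
  intro c hc
  -- The error of the difference quotient in direction `y.2` with step `y.1`. It is continuous at
  -- each `(0, v)` and vanishes there; the tube lemma makes it small uniformly over the unit ball,
  -- and an increment `h` is read as step `‖h‖` in a unit direction.
  let f : ℝ × E → E := fun y => (map (differenceField X) (x, y.2, y.1)).2.1 - L y.2
  have hf : ∀ v, ∀ᶠ y in 𝓝 ((0 : ℝ), v), ‖f y‖ < c := fun v => by
    have h1 : ContinuousAt f (0, v) := by
      have h2 : ContinuousAt (fun y : ℝ × E => map (differenceField X) (x, y.2, y.1)) (0, v) :=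
        ContinuousAt.comp (g := map (differenceField X)) (f := fun y : ℝ × E => (x, y.2, y.1))
          (continuousAt_map hZ1 (hdef v)) (by fun_prop)
      exact h2.snd.fst.sub (by fun_prop)
    have h3 : f (0, v) = 0 := by simp [f, hL]
    have := h1.norm.eventually_lt_const (v := ‖f (0, v)‖) (u := c)
    simp only [h3, norm_zero] at this
    exact this hc
  obtain ⟨u, w, hu, -, h0u, hw, huw⟩ := generalized_tube_lemma
    (isCompact_singleton (x := (0 : ℝ))) (isCompact_closedBall (0 : E) 1)
    (isOpen_interior (s := {y | ‖f y‖ < c})) (by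
      rintro ⟨e, v⟩ ⟨he, -⟩
      obtain rfl : e = 0 := he
      exact mem_interior_iff_mem_nhds.2 (hf v))
  have hu0 : u ∈ 𝓝 (0 : ℝ) := hu.mem_nhds (h0u rfl)
  have hnorm : ∀ᶠ h : E in 𝓝 0, ‖h‖ ∈ u := by
    have : ContinuousAt (fun h : E => ‖h‖) 0 := continuous_norm.continuousAt
    exact this.eventually (by simpa using hu0)
  have hDx : ∀ᶠ h : E in 𝓝 0, Defined X (x + h) := by
    have : ContinuousAt (fun h : E => x + h) 0 := by fun_prop
    exact this.eventually ((isOpen_defined hX1).mem_nhds (by simpa using hx))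
  filter_upwards [hnorm, hDx] with h hh hd
  rcases eq_or_ne h 0 with rfl | h0
  · simp
  have hn : ‖h‖ ≠ 0 := norm_ne_zero_iff.2 h0
  have hsc : ‖h‖ • (‖h‖⁻¹ • h) = h := by rw [smul_smul, mul_inv_cancel₀ hn, one_smul]
  have key := map_differenceField_of_ne hX (v := ‖h‖⁻¹ • h) hn hx (by rwa [hsc])
  have hunit : ‖h‖⁻¹ • h ∈ closedBall (0 : E) 1 := by simp [norm_smul, inv_mul_cancel₀ hn]
  have hsmall : ‖f (‖h‖, ‖h‖⁻¹ • h)‖ < c := by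
    have hmem : (‖h‖, ‖h‖⁻¹ • h) ∈ u ×ˢ w := ⟨hh, hw hunit⟩
    have := interior_subset (huw hmem)
    exact this
  have hval : map X (x + h) - map X x - L h = ‖h‖ • f (‖h‖, ‖h‖⁻¹ • h) := by
    have hLh : L h = ‖h‖ • L (‖h‖⁻¹ • h) := by rw [← map_smul, hsc]
    rw [hsc] at key
    rw [key, hLh]
    simp only [f, smul_sub]
    abel
  rw [hval, norm_smul, norm_norm, mul_comm]
  gcongr

/-- Each directional derivative is a component of the time-one map of `differenceField X`, a smooth
field on `E × E × ℝ`. The induction hypothesis is therefore needed for all spaces at once. -/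
theorem contDiffOn_map_nat (m : ℕ) {X : E → E} (hX : ContDiff ℝ ∞ X) :
    ContDiffOn ℝ m (map X) {z | Defined X z} := by
  induction m generalizing E with
  | zero =>
    exact contDiffOn_zero.2 fun z hz =>
      (continuousAt_map (hX.of_le (by simp)) hz).continuousWithinAt
  | succ m ih =>
    push_cast
    have hX1 : ContDiff ℝ 1 X := hX.of_le (by simp)
    refine (contDiffOn_succ_iff_fderiv_of_isOpen (isOpen_defined hX1)).2
      ⟨fun z hz => ?_, by simp, contDiffOn_clm_apply.2 fun v => ?_⟩
    · obtain ⟨L, hL, -⟩ := exists_hasFDerivAt hX hz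
      exact hL.differentiableAt.differentiableWithinAt
    · have h1 := ih (contDiff_differenceField hX)
      have h2 : ContDiffOn ℝ m (fun x => map (differenceField X) (x, v, 0)) {z | Defined X z} :=
        h1.comp (f := fun x : E => (x, v, (0 : ℝ))) (by fun_prop) fun x hx => by
          obtain ⟨γ, hγ⟩ := hx
          obtain ⟨η, hη⟩ := hγ.exists_variation hX v
          exact ⟨_, hγ.prod_variation hX hη⟩
      refine (h2.snd.fst).congr fun x hx => ?_
      obtain ⟨L, hL, hLv⟩ := exists_hasFDerivAt hX hx
      rw [hL.fderiv, hLv]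

/-- The time-one map of a smooth vector field is smooth on its (open) domain. -/
theorem contDiffOn_map {X : E → E} (hX : ContDiff ℝ ∞ X) :
    ContDiffOn ℝ ∞ (map X) {z | Defined X z} :=
  contDiffOn_infty.2 fun m => contDiffOn_map_nat m hX

/-- The derivative of the time-one map propagates solutions of the variational equation. -/
theorem IsVariation.fderiv_map_eq {X : E → E} (hX : ContDiff ℝ ∞ X) {x v : E} {γ η : ℝ → E}
    (hγ : IsCurve X x γ) (hη : IsVariation X γ v η) : fderiv ℝ (map X) x v = η 1 := by
  obtain ⟨L, hL, hLv⟩ := exists_hasFDerivAt hX ⟨γ, hγ⟩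
  rw [hL.fderiv, hLv, hη.map_eq hX hγ]

end TimeOne

/-! ### Dependence of flows on time, reversal and the local group law. -/

namespace TimeOne

variable {E : Type u} [NormedAddCommGroup E] [NormedSpace ℝ E]

theorem isCurve_zero (z : E) : IsCurve (0 : E → E) z (fun _ => z) :=
  ⟨rfl, fun t _ => hasDerivWithinAt_const t _ _⟩

/-- The suspension of `X`: time becomes an additional, constant coordinate. -/
def suspension (X : E → E) (q : E × ℝ) : E × ℝ := (q.2 • X q.1, 0)

theorem IsCurve.suspension {X : E → E} {c : ℝ} {x : E} {γ : ℝ → E} (hγ : IsCurve (c • X) x γ) :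
    IsCurve (suspension X) (x, c) (fun t => (γ t, c)) :=
  ⟨by simp [hγ.1], fun t ht => (hγ.2 t ht).prodMk (hasDerivWithinAt_const t _ _)⟩

theorem IsCurve.reverse {X : E → E} {z : E} {γ : ℝ → E} (hγ : IsCurve X z γ) :
    IsCurve (-X) (γ 1) (fun t => γ (1 - t)) := by
  refine ⟨by simp, fun t ht => ?_⟩
  have h1 : HasDerivWithinAt (fun t : ℝ => 1 - t) (-1) (Icc 0 1) t := by
    simpa using (hasDerivWithinAt_id t (Icc (0 : ℝ) 1)).const_sub 1
  have h2 : MapsTo (fun t : ℝ => 1 - t) (Icc 0 1) (Icc 0 1) := fun s hs =>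
    ⟨by linarith [hs.2], by linarith [hs.1]⟩
  simpa [Function.comp_def] using (hγ.2 (1 - t) (h2 ht)).scomp t h1 h2

theorem defined_zero_smul (X : E → E) (z : E) : Defined ((0 : ℝ) • X) z := by
  rw [zero_smul]
  exact ⟨_, isCurve_zero z⟩

theorem contDiff_suspension {X : E → E} {m : WithTop ℕ∞} (hX : ContDiff ℝ m X) :
    ContDiff ℝ m (suspension X) :=
  (contDiff_snd.smul (hX.comp contDiff_fst)).prodMk contDiff_const

theorem defined_suspension_iff {X : E → E} {c : ℝ} {x : E} :
    Defined (suspension X) (x, c) ↔ Defined (c • X) x := by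
  refine ⟨fun ⟨q, hq0, hq⟩ => ?_, fun ⟨γ, hγ⟩ => ⟨_, hγ.suspension⟩⟩
  have h2 : IsCurve (fun _ : ℝ => (0 : ℝ)) c fun t => (q t).2 :=
    ⟨by simp [hq0], fun t ht => (hq t ht).snd⟩
  have h2' : IsCurve (fun _ : ℝ => (0 : ℝ)) c fun _ => c :=
    ⟨rfl, fun t _ => hasDerivWithinAt_const t _ _⟩
  refine ⟨fun t => (q t).1, by simp [hq0], fun t ht => ?_⟩
  have h1 := (hq t ht).fst
  have h3 : (q t).2 = c := h2.eqOn contDiff_const h2' ht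
  simp only [TimeOne.suspension, h3] at h1
  exact h1

theorem isCurve_of_hasDerivWithinAt {X : E → E} {γ : ℝ → E} {s : Set ℝ} (a c : ℝ)
    (hs : MapsTo (fun t => a + t * c) (Icc 0 1) s)
    (hγ : ∀ t ∈ s, HasDerivWithinAt γ (X (γ t)) s t) :
    IsCurve (c • X) (γ a) (fun t => γ (a + t * c)) := by
  refine ⟨by simp, fun t ht => ?_⟩
  have h1 : HasDerivWithinAt (fun t : ℝ => a + t * c) c (Icc 0 1) t := by
    simpa using ((hasDerivWithinAt_id t (Icc (0 : ℝ) 1)).mul_const c).const_add a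
  exact (hγ _ (hs ht)).scomp t h1 hs

variable [FiniteDimensional ℝ E]

theorem map_zero_smul (X : E → E) (z : E) : map ((0 : ℝ) • X) z = z := by
  rw [zero_smul, IsCurve.map_eq (X := 0) contDiff_const (isCurve_zero z)]

theorem map_suspension {X : E → E} (hX : ContDiff ℝ 1 X) {c : ℝ} {x : E}
    (h : Defined (c • X) x) : map (suspension X) (x, c) = (map (c • X) x, c) := by
  obtain ⟨γ, hγ⟩ := h
  rw [hγ.suspension.map_eq (contDiff_suspension hX), hγ.map_eq (X := c • X) (hX.const_smul c)]

/-- The flow domain of a smooth field is open. -/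
theorem isOpen_flowDomain {X : E → E} (hX : ContDiff ℝ ∞ X) :
    IsOpen {y : ℝ × E | Defined (y.1 • X) y.2} := by
  have h := (isOpen_defined ((contDiff_suspension hX).of_le (m := 1) (by simp))).preimage
    (by fun_prop : Continuous fun y : ℝ × E => (y.2, y.1))
  simpa only [preimage_ofPred_eq, defined_suspension_iff] using h

/-- The flow of a smooth field is jointly smooth in time and initial value. -/
theorem contDiffOn_flow {X : E → E} (hX : ContDiff ℝ ∞ X) :
    ContDiffOn ℝ ∞ (fun y : ℝ × E => map (y.1 • X) y.2) {y | Defined (y.1 • X) y.2} := by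
  have h := (contDiffOn_map (contDiff_suspension hX)).comp
    (f := (fun y => (y.2, y.1) : ℝ × E → E × ℝ)) (s := {y : ℝ × E | Defined (y.1 • X) y.2})
    (by fun_prop) (fun y hy => defined_suspension_iff.2 hy)
  refine h.fst.congr fun y hy => ?_
  simp [map_suspension (hX.of_le (by simp)) hy]

theorem defined_neg_map {X : E → E} (hX : ContDiff ℝ 1 X) {z : E} (hz : Defined X z) :
    Defined (-X) (map X z) ∧ map (-X) (map X z) = z := by
  obtain ⟨γ, hγ⟩ := hz
  rw [hγ.map_eq hX]
  exact ⟨⟨_, hγ.reverse⟩, by rw [hγ.reverse.map_eq (X := -X) hX.neg]; simp [hγ.1]⟩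

/-- Near each point the flow is given, for a uniform time, by honest integral curves. -/
theorem exists_local_curves {X : E → E} (hX : ContDiff ℝ 1 X) (z₀ : E) :
    ∃ ε > 0, ∀ᶠ z in 𝓝 z₀, ∃ γ : ℝ → E, γ 0 = z ∧
      (∀ t, |t| < ε → HasDerivAt γ (X (γ t)) t) ∧
      ∀ t s, |t| + |s| < ε → map (s • X) (γ t) = γ (t + s) := by
  obtain ⟨r, hr, ε, hε, h⟩ :=
    hX.contDiffAt.exists_forall_mem_closedBall_exists_eq_forall_mem_Ioo_hasDerivAt (x₀ := z₀) 0
  refine ⟨ε, hε, ?_⟩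
  filter_upwards [closedBall_mem_nhds z₀ hr] with z hz
  obtain ⟨γ, h0, hγ⟩ := h z hz
  refine ⟨γ, h0, fun t ht => hγ t (by simpa using abs_lt.1 ht), fun t s hts => ?_⟩
  have hmaps : MapsTo (fun u : ℝ => t + u * s) (Icc 0 1) (Ioo (0 - ε) (0 + ε)) := by
    intro u hu
    have h1 : |t + u * s| ≤ |t| + |s| := by
      refine (abs_add_le _ _).trans ?_
      rw [abs_mul, abs_of_nonneg hu.1]
      gcongr
      exact mul_le_of_le_one_left (abs_nonneg s) hu.2
    simpa using abs_lt.1 (h1.trans_lt hts)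
  have := isCurve_of_hasDerivWithinAt (X := X) (γ := γ) t s hmaps
    fun u hu => (hγ u hu).hasDerivWithinAt
  rw [this.map_eq (X := s • X) (hX.const_smul s)]
  simp

theorem hasDerivAt_flow_zero {X : E → E} (hX : ContDiff ℝ 1 X) (z : E) :
    HasDerivAt (fun t : ℝ => map (t • X) z) (X z) 0 := by
  obtain ⟨ε, hε, h⟩ := exists_local_curves hX z
  obtain ⟨γ, h0, hγ, hmap⟩ := h.self_of_nhds
  have h1 : HasDerivAt γ (X z) 0 := by simpa [h0] using hγ 0 (by simpa using hε)
  refine h1.congr_of_eventuallyEq ?_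
  filter_upwards [ball_mem_nhds (0 : ℝ) hε] with t ht
  have := hmap 0 t (by simpa using ht)
  simpa [h0] using this

/-- All the values are read off a single local integral curve, whose interval of definition is
uniform for `z` near `z₀`. -/
theorem eventually_flow_add {X : E → E} (hX : ContDiff ℝ 1 X) (z₀ : E) :
    ∃ ε > 0, ∀ᶠ z in 𝓝 z₀, ∀ t s : ℝ, |t| + |s| < ε →
      map (s • X) (map (t • X) z) = map ((t + s) • X) z := by
  obtain ⟨ε, hε, h⟩ := exists_local_curves hX z₀
  refine ⟨ε, hε, h.mono fun z ⟨γ, h0, _, hmap⟩ t s hts => ?_⟩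
  have h1 := hmap 0 t (by simpa using lt_of_le_of_lt (le_add_of_nonneg_right (abs_nonneg s)) hts)
  have h2 := hmap 0 (t + s) (by simpa using (abs_add_le t s).trans_lt hts)
  rw [h0, zero_add] at h1 h2
  rw [h1, h2, hmap t s hts]

end TimeOne

/-! ### Translation of flows into time-one maps. -/

namespace ContactSplitting

variable {n : ℕ}

theorem flowDefined_iff {X : Jet n → Jet n} {t : ℝ} {z : Jet n} :
    FlowDefined X t z ↔ TimeOne.Defined (t • X) z := by
  constructor
  · rintro ⟨γ, h0, hγ⟩
    have hmaps : MapsTo (fun u : ℝ => 0 + u * t) (Icc 0 1) (uIcc 0 t) := by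
      intro u hu
      have := (convex_uIcc (0 : ℝ) t).smul_mem_of_zero_mem left_mem_uIcc right_mem_uIcc hu
      simpa using this
    have := TimeOne.isCurve_of_hasDerivWithinAt (X := X) 0 t hmaps hγ
    rw [h0] at this
    exact ⟨_, this⟩
  · rintro ⟨γ, h0, hγ⟩
    rcases eq_or_ne t 0 with rfl | ht
    -- The interval is the single point `0`, within which every derivative condition holds.
    · exact ⟨fun _ => z, rfl, fun s _ => by
        simp only [uIcc_self]
        exact hasDerivWithinAt_iff_hasFDerivWithinAt.2 (.of_finite (finite_singleton _))⟩
    · refine ⟨fun s => γ (s * t⁻¹), by simp [h0], fun s hs => ?_⟩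
      have hmaps : MapsTo (fun u : ℝ => u * t⁻¹) (uIcc 0 t) (Icc 0 1) := by
        intro u hu
        simp only [← div_eq_mul_inv]
        rcases le_total 0 t with h | h
        · rw [uIcc_of_le h] at hu
          exact ⟨div_nonneg hu.1 h, div_le_one_of_le₀ hu.2 h⟩
        · rw [uIcc_of_ge h] at hu
          exact ⟨div_nonneg_of_nonpos hu.2 h, div_le_one_of_ge hu.1 h⟩
      have h1 : HasDerivWithinAt (fun u : ℝ => u * t⁻¹) t⁻¹ (uIcc 0 t) s := by
        simpa using (hasDerivWithinAt_id s (uIcc 0 t)).mul_const t⁻¹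
      have := (hγ _ (hmaps hs)).scomp s h1 hmaps
      simpa [smul_smul, inv_mul_cancel₀ ht, Function.comp_def] using this

theorem flow_eq {X : Jet n → Jet n} (hX : ContDiff ℝ 1 X) (t : ℝ) (z : Jet n) :
    flow X t z = TimeOne.map (t • X) z := by
  by_cases h : FlowDefined X t z
  · have hs := h.choose_spec
    rw [flow, dif_pos h]
    have hmaps : MapsTo (fun u : ℝ => 0 + u * t) (Icc 0 1) (uIcc 0 t) := by
      intro u hu
      have := (convex_uIcc (0 : ℝ) t).smul_mem_of_zero_mem left_mem_uIcc right_mem_uIcc hu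
      simpa using this
    have := TimeOne.isCurve_of_hasDerivWithinAt (X := X) 0 t hmaps hs.2
    rw [hs.1] at this
    rw [this.map_eq (X := t • X) (hX.const_smul t)]
    simp
  · rw [flow, dif_neg h, TimeOne.map, dif_neg (fun h' => h (flowDefined_iff.2 h'))]

end ContactSplitting

/-! Smooth one-parameter families of maps, considered for small parameter `τ`, up to powers of `τ`. -/

namespace SmoothFamily

variable {E F G : Type u} [NormedAddCommGroup E] [NormedSpace ℝ E]
  [NormedAddCommGroup F] [NormedSpace ℝ F] [NormedAddCommGroup G] [NormedSpace ℝ G]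

/-- The family `f (τ, z)` is jointly smooth near the points with `τ = 0`. -/
def Smooth (f : ℝ × E → F) : Prop := ∀ z, ContDiffAt ℝ ∞ f (0, z)

/-- Equality of families for small parameter, locally in the space variable. -/
def GermEq (f g : ℝ × E → F) : Prop := ∀ z, ∀ᶠ y in 𝓝 ((0 : ℝ), z), f y = g y

/-- `f - g` is `τ ^ p` times a smooth family. -/
def CongrMod (p : ℕ) (f g : ℝ × E → F) : Prop :=
  ∃ R : ℝ × E → F, Smooth R ∧ GermEq f (fun y => g y + y.1 ^ p • R y)

/-- Composition of families of maps, parameter by parameter. -/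
def compose (f : ℝ × F → G) (g : ℝ × E → F) (y : ℝ × E) : G := f (y.1, g y)

theorem Smooth.add {f g : ℝ × E → F} (hf : Smooth f) (hg : Smooth g) :
    Smooth (fun y => f y + g y) := fun z => (hf z).add (hg z)

theorem Smooth.pow_smul {f : ℝ × E → F} (hf : Smooth f) (p : ℕ) :
    Smooth (fun y => y.1 ^ p • f y) := fun z => (contDiffAt_fst.pow p).smul (hf z)

theorem Smooth.comp {f : ℝ × F → G} {g : ℝ × E → F} (hf : Smooth f) (hg : Smooth g) :
    Smooth (compose f g) := fun z =>
  ContDiffAt.comp (g := f) (f := fun y => (y.1, g y)) (0, z) (hf (g (0, z)))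
    (contDiffAt_fst.prodMk (hg z))

theorem smooth_snd : Smooth (fun y : ℝ × E => y.2) := fun _ => contDiffAt_snd

theorem smooth_of_contDiff {e : E → F} (he : ContDiff ℝ ∞ e) : Smooth (fun y => e y.2) :=
  fun _ => he.contDiffAt.comp _ contDiffAt_snd

theorem Smooth.congr {f g : ℝ × E → F} (hf : Smooth f) (h : GermEq g f) : Smooth g :=
  fun z => (hf z).congr_of_eventuallyEq (h z)

theorem GermEq.comp_left {H : Type u} {f f' : ℝ × F → H} {g : ℝ × E → F} (h : GermEq f f') (hg : Smooth g) :
    GermEq (compose f g) (compose f' g) := fun z =>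
  ((continuousAt_fst.prodMk (hg z).continuousAt : ContinuousAt (fun y => (y.1, g y)) (0, z))).eventually
    (h (g (0, z)))

theorem GermEq.congrMod {f g : ℝ × E → F} (h : GermEq f g) (p : ℕ) : CongrMod p f g :=
  ⟨fun _ => 0, fun _ => contDiffAt_const, fun z => (h z).mono fun y hy => by simp [hy]⟩

theorem CongrMod.refl (p : ℕ) (f : ℝ × E → F) : CongrMod p f f :=
  GermEq.congrMod (fun _ => .of_forall fun _ => rfl) p

theorem congrMod_of_eq {f g : ℝ × E → F} (h : ∀ y, f y = g y) (p : ℕ) : CongrMod p f g :=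
  GermEq.congrMod (fun _ => .of_forall h) p

theorem CongrMod.symm {p : ℕ} {f g : ℝ × E → F} (h : CongrMod p f g) : CongrMod p g f := by
  obtain ⟨R, hR, h⟩ := h
  exact ⟨fun y => -R y, fun z => (hR z).neg, fun z => (h z).mono fun y hy => by simp [hy]⟩

theorem CongrMod.trans {p : ℕ} {f g k : ℝ × E → F} (h : CongrMod p f g) (h' : CongrMod p g k) :
    CongrMod p f k := by
  obtain ⟨R, hR, h⟩ := h
  obtain ⟨R', hR', h'⟩ := h'
  refine ⟨fun y => R' y + R y, hR'.add hR, fun z => ?_⟩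
  filter_upwards [h z, h' z] with y hy hy'
  rw [hy, hy', smul_add, add_assoc]

theorem CongrMod.add {p : ℕ} {f g f' g' : ℝ × E → F} (h : CongrMod p f g)
    (h' : CongrMod p f' g') : CongrMod p (fun y => f y + f' y) (fun y => g y + g' y) := by
  obtain ⟨R, hR, h⟩ := h
  obtain ⟨R', hR', h'⟩ := h'
  refine ⟨fun y => R y + R' y, hR.add hR', fun z => ?_⟩
  filter_upwards [h z, h' z] with y hy hy'
  rw [hy, hy', smul_add]
  abel

theorem CongrMod.of_le {p q : ℕ} (hpq : p ≤ q) {f g : ℝ × E → F} (h : CongrMod q f g) :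
    CongrMod p f g := by
  obtain ⟨R, hR, h⟩ := h
  refine ⟨_, hR.pow_smul (q - p), fun z => (h z).mono fun y hy => ?_⟩
  beta_reduce at hy ⊢
  rw [hy, smul_smul, ← pow_add, Nat.add_sub_cancel' hpq]

theorem CongrMod.pow_smul {p : ℕ} {f g : ℝ × E → F} (h : CongrMod p f g) (q : ℕ) :
    CongrMod (q + p) (fun y => y.1 ^ q • f y) (fun y => y.1 ^ q • g y) := by
  obtain ⟨R, hR, h⟩ := h
  refine ⟨R, hR, fun z => (h z).mono fun y hy => ?_⟩
  simp only [hy, smul_add, smul_smul, ← pow_add]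

theorem CongrMod.smooth {p : ℕ} {f g : ℝ × E → F} (h : CongrMod p f g) (hg : Smooth g) :
    Smooth f := by
  obtain ⟨R, hR, h⟩ := h
  exact (hg.add (hR.pow_smul p)).congr h

theorem CongrMod.comp_left {p : ℕ} {f f' : ℝ × F → G} {g : ℝ × E → F} (h : CongrMod p f f')
    (hg : Smooth g) : CongrMod p (compose f g) (compose f' g) := by
  obtain ⟨R, hR, h⟩ := h
  exact ⟨_, hR.comp hg, h.comp_left hg⟩

/-- Rescaling of the parameter. -/
theorem CongrMod.rescale {p : ℕ} {f g : ℝ × E → F} (h : CongrMod p f g) (a : ℝ) :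
    CongrMod p (fun y => f (a * y.1, y.2)) (fun y => g (a * y.1, y.2)) := by
  obtain ⟨R, hR, h⟩ := h
  have hc : ∀ z, ContDiffAt ℝ ∞ (fun y : ℝ × E => (a * y.1, y.2)) (0, z) := fun z => by fun_prop
  refine ⟨fun y => a ^ p • R (a * y.1, y.2), fun z => ?_, fun z => ?_⟩
  · refine ContDiffAt.const_smul _ (ContDiffAt.comp (g := R) _ ?_ (hc z))
    simpa using hR z
  · have := (hc z).continuousAt.eventually (p := fun y => f y = g y + y.1 ^ p • R y)
      (by simpa using h z)
    refine this.mono fun y hy => ?_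
    beta_reduce
    rw [hy, mul_pow, smul_smul, mul_comm (y.1 ^ p)]

/-- The coefficient is the remainder at `τ = 0`; Hadamard's lemma extracts one more factor `τ` from
the rest. -/
theorem CongrMod.exists_coeff {p : ℕ} {f g : ℝ × E → F} (h : CongrMod p f g)
    [FiniteDimensional ℝ E] [CompleteSpace F] :
    ∃ e : E → F, ContDiff ℝ ∞ e ∧ CongrMod (p + 1) f (fun y => g y + y.1 ^ p • e y.2) := by
  obtain ⟨R, hR, h⟩ := h
  refine ⟨fun z => R (0, z), contDiff_iff_contDiffAt.2 fun z => ?_, ?_⟩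
  · exact (hR z).comp z (contDiffAt_const.prodMk contDiffAt_id)
  · refine ⟨fun y => dslope (fun τ => R (τ, y.2)) 0 y.1, fun z => (hR z).dslope_zero,
      fun z => (h z).mono fun y hy => ?_⟩
    have := sub_smul_dslope (fun τ => R (τ, y.2)) 0 y.1
    rw [sub_zero] at this
    beta_reduce at hy ⊢
    rw [hy, add_assoc, pow_succ, mul_smul, this, ← smul_add]
    simp

section

variable [CompleteSpace G]

/-- Replace `τ ^ p` in `f(τ, g' + τ ^ p R)` by an independent variable `σ` and apply Hadamard's
lemma in `σ`. With `p ≠ 0` the value `σ = τ ^ p` tends to `0`, so smoothness near `σ = 0` is enough.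
-/
theorem CongrMod.comp_right [FiniteDimensional ℝ F] {p : ℕ} (hp : p ≠ 0) {f : ℝ × F → G} (hf : Smooth f)
    {g g' : ℝ × E → F} (h : CongrMod p g g') (hg' : Smooth g') :
    CongrMod p (compose f g) (compose f g') := by
  obtain ⟨R, hR, h⟩ := h
  let k : ℝ × (ℝ × F × F) → G := fun q => f (q.2.1, q.2.2.1 + q.1 • q.2.2.2)
  have hk : ∀ y r, ContDiffAt ℝ ∞ k (0, (0, y, r)) := fun y r => by
    refine ContDiffAt.comp (g := f) (f := fun q : ℝ × (ℝ × F × F) =>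
      (q.2.1, q.2.2.1 + q.1 • q.2.2.2)) _ ?_ (by fun_prop)
    simpa using hf y
  refine ⟨fun y => dslope (fun σ => k (σ, (y.1, g' y, R y))) 0 (y.1 ^ p), fun z => ?_, fun z => ?_⟩
  · have h1 := (hk (g' (0, z)) (R (0, z))).dslope_zero
    have h2 : ContDiffAt ℝ ∞ (fun y : ℝ × E => (y.1 ^ p, (y.1, g' y, R y))) (0, z) :=
      (contDiffAt_fst.pow p).prodMk (contDiffAt_fst.prodMk ((hg' z).prodMk (hR z)))
    refine ContDiffAt.comp (g := fun q : ℝ × (ℝ × F × F) => dslope (fun σ => k (σ, q.2)) 0 q.1)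
      _ ?_ h2
    simpa [hp] using h1
  · refine (h z).mono fun y hy => ?_
    have := sub_smul_dslope (fun σ => k (σ, (y.1, g' y, R y))) 0 (y.1 ^ p)
    rw [sub_zero] at this
    beta_reduce at hy ⊢
    rw [this]
    simp [compose, k, hy]

variable [FiniteDimensional ℝ E]

theorem congrMod_one {f : ℝ × E → G} (hf : Smooth f) : CongrMod 1 f (fun y => f (0, y.2)) := by
  refine ⟨fun y => dslope (fun τ => f (τ, y.2)) 0 y.1, fun z => (hf z).dslope_zero,
    fun z => .of_forall fun y => ?_⟩
  have := sub_smul_dslope (fun τ => f (τ, y.2)) 0 y.1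
  rw [sub_zero] at this
  beta_reduce
  rw [pow_one, this]
  simp

/-- First-order Taylor expansion in the parameter. -/
theorem congrMod_two {f : ℝ × E → G} (hf : Smooth f) {e : E → G}
    (he : ∀ z, HasDerivAt (fun τ => f (τ, z)) (e z) 0) :
    CongrMod 2 f (fun y => f (0, y.2) + y.1 • e y.2) := by
  have h1 : Smooth (fun y : ℝ × E => dslope (fun τ => f (τ, y.2)) 0 y.1) :=
    fun z => (hf z).dslope_zero
  have h2 : CongrMod 1 (fun y : ℝ × E => dslope (fun τ => f (τ, y.2)) 0 y.1) (fun y => e y.2) := by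
    refine (congrMod_one h1).trans (congrMod_of_eq (fun y => ?_) 1)
    simp [(he y.2).deriv]
  have h3 := (CongrMod.refl 2 (fun y : ℝ × E => f (0, y.2))).add (h2.pow_smul 1)
  refine (congrMod_of_eq (fun y => ?_) 2).trans (h3.trans (congrMod_of_eq (fun y => ?_) 2))
  · have := sub_smul_dslope (fun τ => f (τ, y.2)) 0 y.1
    rw [sub_zero] at this
    rw [pow_one, this]
    simp
  · simp

end

/-! ### Leading terms of compositions, inverses and commutators. -/

section Expansion

/-- The family is smooth and starts at the identity. -/
def NearId (S : ℝ × E → E) : Prop := Smooth S ∧ ∀ z, S (0, z) = z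

theorem NearId.comp {S S' : ℝ × E → E} (hS : NearId S) (hS' : NearId S') :
    NearId (compose S S') :=
  ⟨hS.1.comp hS'.1, fun z => by simp [compose, hS.2, hS'.2]⟩

variable [FiniteDimensional ℝ E]

theorem NearId.congrMod {S : ℝ × E → E} (hS : NearId S) : CongrMod 1 S (fun y => y.2) := by
  simpa [hS.2] using congrMod_one hS.1

/-- Write `S = id + τ T`. The identity passes the perturbation through unchanged, and its effect on
`T` carries the extra factor `τ`. -/
theorem NearId.comp_add {p : ℕ} (hp : p ≠ 0) {S : ℝ × E → E} (hS : NearId S) {k r : ℝ × E → E}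
    (hk : Smooth k) (hr : Smooth r) :
    CongrMod (p + 1) (compose S (fun y => k y + y.1 ^ p • r y))
      (fun y => compose S k y + y.1 ^ p • r y) := by
  let T : ℝ × E → E := fun y => dslope (fun τ => S (τ, y.2)) 0 y.1
  have hT : Smooth T := fun z => (hS.1 z).dslope_zero
  have hST : ∀ y, S y = y.2 + y.1 • T y := fun y => by
    have := sub_smul_dslope (fun τ => S (τ, y.2)) 0 y.1
    rw [sub_zero] at this
    simp only [T, this, hS.2]
    simp
  have h1 : CongrMod p (fun y => k y + y.1 ^ p • r y) k :=
    ⟨r, hr, fun z => .of_forall fun y => rfl⟩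
  have h2 := (h1.comp_right hp hT hk).pow_smul 1
  rw [add_comm 1 p] at h2
  have h3 := (CongrMod.refl (p + 1) (fun y => k y + y.1 ^ p • r y)).add h2
  refine (congrMod_of_eq (fun y => ?_) _).trans (h3.trans (congrMod_of_eq (fun y => ?_) _))
  · simp only [compose]
    rw [hST]
    simp
  · simp only [compose]
    rw [hST (y.1, k y)]
    simp only [pow_one]
    abel

theorem CongrMod.comp_coeff {e : E → F} (he : ContDiff ℝ ∞ e) [CompleteSpace F] {g : ℝ × E → E}
    (hg : CongrMod 1 g (fun y => y.2)) : CongrMod 1 (fun y => e (g y)) (fun y => e y.2) :=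
  hg.comp_right one_ne_zero (f := fun y : ℝ × E => e y.2) (smooth_of_contDiff he) smooth_snd

/-- Leading error coefficients add under composition. -/
theorem CongrMod.comp_expansion {p : ℕ} (hp : p ≠ 0) {S S' f g : ℝ × E → E} {e e' : E → E}
    (hS : NearId S) (hS' : NearId S') (he : ContDiff ℝ ∞ e) (he' : ContDiff ℝ ∞ e')
    (hf : CongrMod (p + 1) f (fun y => S y + y.1 ^ p • e y.2))
    (hg : CongrMod (p + 1) g (fun y => S' y + y.1 ^ p • e' y.2)) :
    CongrMod (p + 1) (compose f g) (fun y => compose S S' y + y.1 ^ p • (e y.2 + e' y.2)) := by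
  have hse' := smooth_of_contDiff he'
  have hk := hS'.1.add (hse'.pow_smul p)
  have hgs : Smooth g := hg.smooth hk
  have hg1 : CongrMod 1 g (fun y => y.2) := by
    refine (hg.of_le (by omega)).trans (CongrMod.trans ?_ hS'.congrMod)
    exact CongrMod.of_le (q := p) (by omega) ⟨_, hse', fun z => .of_forall fun y => rfl⟩
  -- The terms of `f ∘ g` are treated separately: `S ∘ g` passes the error of `g` through `S`, and
  -- `e ∘ g` may be replaced by `e` because `g` is the identity modulo `τ`.
  have h1 := hf.comp_left hgs
  have h2 := (hg.comp_right (Nat.succ_ne_zero p) hS.1 hk).trans (hS.comp_add hp hS'.1 hse')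
  have h3 := (CongrMod.comp_coeff he hg1).pow_smul p
  refine h1.trans ((h2.add h3).trans (congrMod_of_eq (fun y => ?_) _))
  rw [smul_add]
  abel

/-- The leading error coefficient of the inverse family. -/
theorem CongrMod.inverse_expansion {p : ℕ} (hp : p ≠ 0) {S S' f g : ℝ × E → E} {e : E → E}
    (hS : NearId S) (hS' : NearId S') (he : ContDiff ℝ ∞ e)
    (hf : CongrMod (p + 1) f (fun y => S y + y.1 ^ p • e y.2))
    (hSS' : GermEq (compose S S') (fun y => y.2)) (hg : Smooth g)
    (hgf : GermEq (compose g f) (fun y => y.2)) :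
    CongrMod (p + 1) g (fun y => S' y + y.1 ^ p • (-e y.2)) := by
  have hg' : Smooth (fun y : ℝ × E => S' y + y.1 ^ p • (-e y.2)) :=
    hS'.1.add ((smooth_of_contDiff he.neg).pow_smul p)
  have h1 := CongrMod.comp_expansion hp hS hS' he he.neg hf (CongrMod.refl _ _)
  -- The candidate is an approximate right inverse of `f`. Applying the exact left inverse `g` to
  -- both sides identifies it with `g`.
  have h2 : CongrMod (p + 1) (compose f fun y => S' y + y.1 ^ p • (-e y.2)) (fun y => y.2) :=
    h1.trans (GermEq.congrMod (fun z => (hSS' z).mono fun y hy => by simp [hy]) _)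
  have h3 := (h2.comp_right (Nat.succ_ne_zero p) hg smooth_snd).symm
  have h4 := (hgf.comp_left hg').congrMod (p + 1)
  exact h3.trans h4

/-- The second-order expansion of a composition of two families. -/
theorem CongrMod.comp_second_order {A B : ℝ × E → E} {a b q r : E → E}
    (ha : ContDiff ℝ ∞ a) (hb : ContDiff ℝ ∞ b) (hq : ContDiff ℝ ∞ q)
    (hB : NearId B)
    (hAq : CongrMod 3 A (fun y => y.2 + y.1 • a y.2 + y.1 ^ 2 • q y.2))
    (hBr : CongrMod 3 B (fun y => y.2 + y.1 • b y.2 + y.1 ^ 2 • r y.2))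
    (hBb : CongrMod 2 B (fun y => y.2 + y.1 • b y.2)) :
    CongrMod 3 (compose A B) (fun y => (y.2 + y.1 • (a y.2 + b y.2) + y.1 ^ 2 • (q y.2 + r y.2)) +
      y.1 ^ 2 • fderiv ℝ a y.2 (b y.2)) := by
  have h1 := hAq.comp_left hB.1
  have hlin : Smooth (fun y : ℝ × E => y.2 + y.1 • b y.2) := by
    simpa using smooth_snd.add ((smooth_of_contDiff hb).pow_smul 1)
  -- This term gets multiplied by `τ`, so accuracy modulo `τ²` suffices.
  have h2 : CongrMod 2 (fun y => a (B y)) (fun y => a y.2 + y.1 • fderiv ℝ a y.2 (b y.2)) := by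
    have h3 := hBb.comp_right two_ne_zero (f := fun y : ℝ × E => a y.2) (smooth_of_contDiff ha) hlin
    have h4 := congrMod_two (f := fun y : ℝ × E => a (y.2 + y.1 • b y.2))
      (e := fun z => fderiv ℝ a z (b z)) ((smooth_of_contDiff ha).comp hlin) (fun z => by
        have h5 : HasDerivAt (fun τ : ℝ => z + τ • b z) (b z) 0 := by
          simpa using ((hasDerivAt_id (0 : ℝ)).smul_const (b z)).const_add z
        have h6 : HasFDerivAt a (fderiv ℝ a z) (z + (0 : ℝ) • b z) := by
          simpa using (ha.differentiable (by simp) z).hasFDerivAt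
        exact h6.comp_hasDerivAt 0 h5)
    refine h3.trans (h4.trans (congrMod_of_eq (fun y => ?_) _))
    simp
  have h3 := (CongrMod.comp_coeff hq hB.congrMod).pow_smul 2
  have h4 := (hBr.add (h2.pow_smul 1)).add h3
  refine h1.trans ((congrMod_of_eq (fun y => ?_) _).trans
    (h4.trans (congrMod_of_eq (fun y => ?_) _)))
  · simp [compose]
  · simp only [pow_one, smul_add, smul_smul, pow_two]
    abel

/-- The commutator of two near-identity families, to leading order. -/
theorem commutator_expansion {A B A' B' : ℝ × E → E} {a b : E → E}
    (ha : ContDiff ℝ ∞ a) (hb : ContDiff ℝ ∞ b) (hA : NearId A) (hB : NearId B)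
    (hA' : Smooth A') (hB' : Smooth B')
    (hAa : ∀ z, HasDerivAt (fun τ => A (τ, z)) (a z) 0)
    (hBb : ∀ z, HasDerivAt (fun τ => B (τ, z)) (b z) 0)
    (hAA : GermEq (compose A' A) (fun y => y.2)) (hBB : GermEq (compose B' B) (fun y => y.2)) :
    CongrMod 3 (compose A' (compose B' (compose A B)))
      (fun y => y.2 + y.1 ^ 2 • (fderiv ℝ a y.2 (b y.2) - fderiv ℝ b y.2 (a y.2))) := by
  have hA2 : CongrMod 2 A (fun y => y.2 + y.1 • a y.2) := by
    simpa [hA.2] using congrMod_two hA.1 hAa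
  have hB2 : CongrMod 2 B (fun y => y.2 + y.1 • b y.2) := by
    simpa [hB.2] using congrMod_two hB.1 hBb
  obtain ⟨q, hq, hA3⟩ := CongrMod.exists_coeff hA2
  obtain ⟨r, hr, hB3⟩ := CongrMod.exists_coeff hB2
  have hAB := CongrMod.comp_second_order ha hb hq hB hA3 hB3 hB2
  have hBA := CongrMod.comp_second_order hb ha hr hA hB3 hA3 hA2
  let e : E → E := fun z => fderiv ℝ a z (b z) - fderiv ℝ b z (a z)
  have he : ContDiff ℝ ∞ e :=
    ((ha.fderiv_right (by simp)).clm_apply hb).sub ((hb.fderiv_right (by simp)).clm_apply ha)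
  have hC : Smooth (fun y : ℝ × E => y.2 + y.1 ^ 2 • e y.2) :=
    smooth_snd.add ((smooth_of_contDiff he).pow_smul 2)
  have hD : NearId (compose B A) := hB.comp hA
  have h1 := hD.comp_add two_ne_zero smooth_snd (smooth_of_contDiff he)
  -- The second-order terms of `A ∘ B` and `B ∘ A` differ only in the cross derivatives, so `A ∘ B`
  -- is `B ∘ A` after `id + τ² e`. Composing with `A' ∘ B'` cancels `B ∘ A`.
  have h2 : CongrMod 3 (compose A B) (compose (compose B A) fun y : ℝ × E => y.2 + y.1 ^ 2 • e y.2) := by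
    refine CongrMod.trans ?_ h1.symm
    refine hAB.trans (CongrMod.trans (congrMod_of_eq (fun y => ?_) _)
      ((hBA.add (CongrMod.refl 3 fun y : ℝ × E => y.1 ^ 2 • e y.2)).symm))
    simp only [e, smul_sub, smul_add]
    abel
  have h3 := h2.comp_right three_ne_zero (hA'.comp hB') (hD.1.comp hC)
  have h4 : GermEq (compose (compose A' B') (compose B A)) (fun y => y.2) := fun z => by
    filter_upwards [(hBB.comp_left hA.1) z, hAA z] with y hy hy'
    simp only [compose] at hy hy' ⊢
    rw [hy, hy']
  exact h3.trans ((h4.comp_left hC).congrMod 3)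

end Expansion

end SmoothFamily

/-! ### Contact Hamiltonian fields, the Jacobi bracket and the conformal factor. -/

namespace ContactSplitting

variable {n : ℕ}

/-- Expansion of a linear map in the coordinate directions of the jet space. -/
theorem clm_apply_eq_sum {F : Type*} [NormedAddCommGroup F] [NormedSpace ℝ F]
    (L : Jet n →L[ℝ] F) (w : Jet n) :
    L w = ∑ i, w.1 i • L (Pi.single i 1, 0, 0) + w.2.1 • L (0, 1, 0) +
      ∑ i, w.2.2 i • L (0, 0, Pi.single i 1) := by
  have hw : w = ∑ i, w.1 i • ((Pi.single i 1, 0, 0) : Jet n) + w.2.1 • ((0, 1, 0) : Jet n) +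
      ∑ i, w.2.2 i • ((0, 0, Pi.single i 1) : Jet n) := by
    have h1 : ∀ v : Fin n → ℝ, ∑ i, v i • (Pi.single i 1 : Fin n → ℝ) = v := fun v => by
      funext j
      simp [Finset.sum_apply, Pi.single_apply]
    refine Prod.ext ?_ (Prod.ext ?_ ?_)
    · simp [Prod.fst_sum, h1]
    · simp [Prod.fst_sum, Prod.snd_sum]
    · simp [Prod.snd_sum, h1]
  conv_lhs => rw [hw]
  simp only [map_add, map_sum, map_smul]

theorem fderiv_apply_eq_sum (H : Jet n → ℝ) (z w : Jet n) :
    fderiv ℝ H z w = ∑ i, w.1 i * dx H i z + w.2.1 * du H z + ∑ i, w.2.2 i * dp H i z := by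
  rw [clm_apply_eq_sum]
  rfl

theorem contDiff_fderiv_apply {H : Jet n → ℝ} (hH : ContDiff ℝ ∞ H) (v : Jet n) :
    ContDiff ℝ ∞ (fun z => fderiv ℝ H z v) :=
  (hH.fderiv_right (by simp)).clm_apply contDiff_const

theorem contDiff_dx {H : Jet n → ℝ} (hH : ContDiff ℝ ∞ H) (i : Fin n) : ContDiff ℝ ∞ (dx H i) :=
  contDiff_fderiv_apply hH _

theorem contDiff_du {H : Jet n → ℝ} (hH : ContDiff ℝ ∞ H) : ContDiff ℝ ∞ (du H) :=
  contDiff_fderiv_apply hH _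

theorem contDiff_dp {H : Jet n → ℝ} (hH : ContDiff ℝ ∞ H) (i : Fin n) : ContDiff ℝ ∞ (dp H i) :=
  contDiff_fderiv_apply hH _

/-- The coordinate `pᵢ` as a linear form. -/
def momentum (i : Fin n) : Jet n →L[ℝ] ℝ :=
  (ContinuousLinearMap.proj i).comp ((ContinuousLinearMap.snd ℝ ℝ (Fin n → ℝ)).comp
    (ContinuousLinearMap.snd ℝ (Fin n → ℝ) (ℝ × (Fin n → ℝ))))

theorem momentum_apply (i : Fin n) (z : Jet n) : momentum i z = z.2.2 i := rfl

theorem contDiff_momentum (i : Fin n) : ContDiff ℝ ∞ (fun z : Jet n => z.2.2 i) := by fun_prop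

theorem contDiff_contactField {H : Jet n → ℝ} (hH : ContDiff ℝ ∞ H) :
    ContDiff ℝ ∞ (contactField H) :=
  (contDiff_pi.2 fun i => contDiff_dp hH i).prodMk
    (((ContDiff.sum fun i _ => (contDiff_momentum i).mul (contDiff_dp hH i)).sub hH).prodMk
      (contDiff_pi.2 fun i =>
        ((contDiff_dx hH i).add ((contDiff_momentum i).mul (contDiff_du hH))).neg))

theorem contDiff_jacobi {H K : Jet n → ℝ} (hH : ContDiff ℝ ∞ H) (hK : ContDiff ℝ ∞ K) :
    ContDiff ℝ ∞ (jacobi H K) := by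
  have hE : ∀ {H : Jet n → ℝ}, ContDiff ℝ ∞ H → ContDiff ℝ ∞ (euler H) := fun h =>
    h.sub (ContDiff.sum fun i _ => (contDiff_momentum i).mul (contDiff_dp h i))
  have hP : ContDiff ℝ ∞ (poisson H K) := ContDiff.sum fun i _ =>
    ((contDiff_dp hH i).mul (contDiff_dx hK i)).sub ((contDiff_dx hH i).mul (contDiff_dp hK i))
  exact (hP.add ((contDiff_du hH).mul (hE hK))).sub ((contDiff_du hK).mul (hE hH))

theorem contactField_add {H K : Jet n → ℝ} (hH : Differentiable ℝ H) (hK : Differentiable ℝ K) :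
    contactField (fun z => H z + K z) = fun z => contactField H z + contactField K z := by
  funext z
  have h : fderiv ℝ (fun z => H z + K z) z = fderiv ℝ H z + fderiv ℝ K z :=
    fderiv_fun_add (hH z) (hK z)
  refine Prod.ext ?_ (Prod.ext ?_ ?_)
  · funext i
    simp [contactField, dp, h]
  · simp only [contactField, dp, h, add_apply, Prod.snd_add, Prod.fst_add,
      mul_add, Finset.sum_add_distrib]
    ring
  · funext i
    simp only [contactField, dx, du, h, add_apply, Prod.snd_add, Pi.add_apply]
    ring

theorem contactField_zero : contactField (fun _ : Jet n => (0 : ℝ)) = fun _ => 0 := by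
  funext z
  refine Prod.ext ?_ (Prod.ext ?_ ?_)
  · funext i
    simp [contactField, dp]
  · simp [contactField, dp]
  · funext i
    simp [contactField, dx, du]

theorem contactField_sum {ι : Type*} (t : Finset ι) {H : ι → Jet n → ℝ}
    (hH : ∀ i, Differentiable ℝ (H i)) :
    contactField (fun z => ∑ i ∈ t, H i z) = fun z => ∑ i ∈ t, contactField (H i) z := by
  classical
  induction t using Finset.induction_on with
  | empty => simpa using contactField_zero
  | insert a t ha ih =>
    simp only [Finset.sum_insert ha]
    rw [contactField_add (hH a) (by fun_prop), ih]

/-- The Jacobi bracket in terms of the contact Hamiltonian field of its first argument. -/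
theorem jacobi_eq (H K : Jet n → ℝ) (z : Jet n) :
    jacobi H K z = fderiv ℝ K z (contactField H z) + du H z * K z := by
  rw [fderiv_apply_eq_sum]
  simp only [jacobi, poisson, euler, contactField, mul_sub, Finset.mul_sum, sub_mul, Finset.sum_mul,
    neg_mul, add_mul, Finset.sum_sub_distrib, Finset.sum_add_distrib, Finset.sum_neg_distrib]
  have h2 : ∑ i, du H z * (z.2.2 i * dp K i z) = ∑ i, z.2.2 i * du H z * dp K i z :=
    Finset.sum_congr rfl fun i _ => by ring
  have h3 : ∑ i, du K z * (z.2.2 i * dp H i z) = ∑ i, z.2.2 i * dp H i z * du K z :=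
    Finset.sum_congr rfl fun i _ => by ring
  rw [h2, h3]
  ring

/-- The second derivative of `H` at `z`. -/
def hess (H : Jet n → ℝ) (z : Jet n) : Jet n →L[ℝ] Jet n →L[ℝ] ℝ := fderiv ℝ (fderiv ℝ H) z

theorem hess_symm {H : Jet n → ℝ} (hH : ContDiff ℝ ∞ H) (z v w : Jet n) :
    hess H z v w = hess H z w v :=
  (hH.contDiffAt.isSymmSndFDerivAt (by
    rw [minSmoothness_of_isRCLikeNormedField]; exact WithTop.coe_le_coe.2 le_top)).eq v w

theorem hasFDerivAt_fderiv_apply {H : Jet n → ℝ} (hH : ContDiff ℝ ∞ H) (z v : Jet n) :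
    HasFDerivAt (fun y => fderiv ℝ H y v) ((hess H z).flip v) z := by
  have h1 : HasFDerivAt (fderiv ℝ H) (hess H z) z :=
    ((hH.fderiv_right (m := ∞) (by simp)).differentiable (by simp) z).hasFDerivAt
  simpa using h1.clm_apply (hasFDerivAt_const v z)

/-- The derivative of a contact Hamiltonian field. -/
theorem fderiv_contactField {H : Jet n → ℝ} (hH : ContDiff ℝ ∞ H) (z w : Jet n) :
    fderiv ℝ (contactField H) z w =
      (fun i => hess H z w (0, 0, Pi.single i 1),
        (∑ i, (w.2.2 i * dp H i z + z.2.2 i * hess H z w (0, 0, Pi.single i 1))) - fderiv ℝ H z w,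
        fun i => -(hess H z w (Pi.single i 1, 0, 0) +
          (w.2.2 i * du H z + z.2.2 i * hess H z w (0, 1, 0)))) := by
  have hp : ∀ i : Fin n, HasFDerivAt (fun y : Jet n => y.2.2 i) (momentum i) z := fun i =>
    (momentum i).hasFDerivAt
  have h := (hasFDerivAt_pi.2 fun i => hasFDerivAt_fderiv_apply hH z (0, 0, Pi.single i 1)).prodMk
    (((HasFDerivAt.fun_sum (u := Finset.univ) fun i _ =>
        (hp i).mul (hasFDerivAt_fderiv_apply hH z (0, 0, Pi.single i 1))).sub
          (hH.differentiable (by simp) z).hasFDerivAt).prodMk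
      (hasFDerivAt_pi.2 fun i => ((hasFDerivAt_fderiv_apply hH z (Pi.single i 1, 0, 0)).add
        ((hp i).mul (hasFDerivAt_fderiv_apply hH z (0, 1, 0)))).neg))
  have h' : HasFDerivAt (contactField H) _ z := h
  rw [h'.fderiv]
  refine Prod.ext ?_ (Prod.ext ?_ ?_)
  · funext i
    simp
  · simp [dp, momentum_apply]
    exact Finset.sum_congr rfl fun i _ => by ring
  · funext i
    simp [du, momentum_apply]
    ring

/-- Differentiate `jacobi_eq`. The derivative of `X_H` paired with `dK` yields the Hessian of `H`
applied to `X_K`, and of the first-order terms only those in the `x`-components of `w` fail to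
cancel. -/
theorem fderiv_jacobi {H K : Jet n → ℝ} (hH : ContDiff ℝ ∞ H) (hK : ContDiff ℝ ∞ K)
    (z w : Jet n) :
    fderiv ℝ (jacobi H K) z w = hess K z w (contactField H z) - hess H z w (contactField K z) +
      (du H z * ∑ i, w.1 i * dx K i z - du K z * ∑ i, w.1 i * dx H i z) := by
  have h1 : HasFDerivAt (fderiv ℝ K) (hess K z) z :=
    ((hK.fderiv_right (m := ∞) (by simp)).differentiable (by simp) z).hasFDerivAt
  have h2 := ((contDiff_contactField hH).differentiable (by simp) z).hasFDerivAt
  have h3 := (hK.differentiable (by simp) z).hasFDerivAt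
  have h4 := (h1.clm_apply h2).add ((hasFDerivAt_fderiv_apply hH z (0, 1, 0)).mul h3)
  have h5 : HasFDerivAt (jacobi H K) _ z :=
    h4.congr_of_eventuallyEq (.of_forall fun y => jacobi_eq H K y)
  rw [h5.fderiv]
  have h6 : hess H z w (contactField K z) = _ := clm_apply_eq_sum (hess H z w) (contactField K z)
  simp only [add_apply, ContinuousLinearMap.comp_apply, ContinuousLinearMap.flip_apply, smul_apply]
  rw [fderiv_contactField hH, fderiv_apply_eq_sum K z w, fderiv_apply_eq_sum K, h6,
    fderiv_apply_eq_sum H z w]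
  simp only [contactField, smul_eq_mul]
  change _ + _ + (du H z * _ + _) = _
  simp only [mul_add, add_mul, sub_mul, neg_mul, Finset.mul_sum, Finset.sum_mul,
    Finset.sum_add_distrib, Finset.sum_neg_distrib]
  simp only [mul_assoc, mul_comm, mul_left_comm]
  ring

/-- The contact Hamiltonian field of the Jacobi bracket is the Lie bracket of the fields. -/
theorem contactField_jacobi {H K : Jet n → ℝ} (hH : ContDiff ℝ ∞ H) (hK : ContDiff ℝ ∞ K)
    (z : Jet n) :
    contactField (jacobi H K) z = fderiv ℝ (contactField K) z (contactField H z) -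
      fderiv ℝ (contactField H) z (contactField K z) := by
  -- Symmetry of the Hessians moves the coordinate direction to the second slot, as in
  -- `fderiv_contactField`.
  have hdp : ∀ i, dp (jacobi H K) i z = hess K z (contactField H z) (0, 0, Pi.single i 1) -
      hess H z (contactField K z) (0, 0, Pi.single i 1) := fun i => by
    rw [dp, fderiv_jacobi hH hK, hess_symm hH z (0, 0, Pi.single i 1),
      hess_symm hK z (0, 0, Pi.single i 1)]
    simp
  have hdu : du (jacobi H K) z = hess K z (contactField H z) (0, 1, 0) -
      hess H z (contactField K z) (0, 1, 0) := by
    rw [du, fderiv_jacobi hH hK, hess_symm hH z (0, 1, 0), hess_symm hK z (0, 1, 0)]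
    simp
  have hdx : ∀ i, dx (jacobi H K) i z = hess K z (contactField H z) (Pi.single i 1, 0, 0) -
      hess H z (contactField K z) (Pi.single i 1, 0, 0) +
        (du H z * dx K i z - du K z * dx H i z) := fun i => by
    rw [dx, fderiv_jacobi hH hK, hess_symm hH z (Pi.single i 1, 0, 0),
      hess_symm hK z (Pi.single i 1, 0, 0)]
    simp [Pi.single_apply]
  have hX : ∀ (L : Jet n → ℝ) i, (contactField L z).2.2 i = -(dx L i z + z.2.2 i * du L z) :=
    fun _ _ => rfl
  rw [fderiv_contactField hH, fderiv_contactField hK]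
  refine Prod.ext ?_ (Prod.ext ?_ ?_)
  · funext i
    exact hdp i
  · have hu : (contactField (jacobi H K) z).2.1 =
        ∑ i, z.2.2 i * dp (jacobi H K) i z - jacobi H K z := rfl
    rw [hu, jacobi_eq]
    simp only [hdp, Prod.snd_sub, Prod.fst_sub]
    rw [fderiv_apply_eq_sum H z (contactField K z)]
    simp only [hX]
    have h1 : (contactField K z).2.1 = ∑ i, z.2.2 i * dp K i z - K z := rfl
    have h2 : ∀ i, (contactField K z).1 i = dp K i z := fun _ => rfl
    simp only [h1, h2, add_mul, mul_sub, sub_mul, neg_mul, Finset.sum_mul,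
      Finset.sum_add_distrib, Finset.sum_sub_distrib, Finset.sum_neg_distrib]
    simp only [mul_comm, mul_left_comm]
    ring
  · funext i
    have hp : (contactField (jacobi H K) z).2.2 i =
        -(dx (jacobi H K) i z + z.2.2 i * du (jacobi H K) z) := rfl
    rw [hp, hdx, hdu]
    simp only [Prod.snd_sub, Pi.sub_apply, hX]
    ring

/-- Along a contact flow the contact form is multiplied by a positive factor. -/
theorem exists_contactForm_fderiv {H : Jet n → ℝ} (hH : ContDiff ℝ ∞ H) (t : ℝ) {z : Jet n}
    (hz : TimeOne.Defined (t • contactField H) z) :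
    ∃ l : ℝ, ∀ v, contactForm (TimeOne.map (t • contactField H) z)
      (fderiv ℝ (TimeOne.map (t • contactField H)) z v) = Real.exp l * contactForm z v := by
  have hX : ContDiff ℝ ∞ (t • contactField H) := (contDiff_contactField hH).const_smul t
  obtain ⟨γ, hγ⟩ := hz
  -- Since `L_{X_H} α = -H_u α`, the pairing `f` of `α` with a variation solves `f' = a f` on the
  -- unit interval. The extension makes `a` continuous on all of `ℝ`, for use with the fundamental
  -- theorem of calculus.
  let a : ℝ → ℝ := IccExtend (zero_le_one (α := ℝ)) ((Icc 0 1).domRestrict fun s => -t * du H (γ s))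
  have ha : Continuous a := by
    refine Continuous.Icc_extend' (continuousOn_iff_continuous_domRestrict.1 ?_)
    exact continuousOn_const.mul
      ((contDiff_du hH).continuous.comp_continuousOn hγ.continuousOn)
  have haγ : ∀ s ∈ Icc (0 : ℝ) 1, a s = -t * du H (γ s) := fun s hs => by
    simp only [a, IccExtend_of_mem _ _ hs]
    rfl
  refine ⟨∫ s in (0 : ℝ)..1, a s, fun v => ?_⟩
  obtain ⟨η, hη⟩ := hγ.exists_variation hX v
  rw [hη.fderiv_map_eq hX hγ, hγ.map_eq (hX.of_le (by simp))]
  let f : ℝ → ℝ := fun s => contactForm (γ s) (η s)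
  have hf : ∀ s ∈ Icc (0 : ℝ) 1, HasDerivWithinAt f (a s * f s) (Icc 0 1) s := by
    intro s hs
    have h1 := hγ.2 s hs
    have h2 := hη.2 s hs
    have h3 : fderiv ℝ (t • contactField H) (γ s) (η s) =
        t • fderiv ℝ (contactField H) (γ s) (η s) := by
      rw [fderiv_const_smul ((contDiff_contactField hH).differentiable (by simp) _)]
      rfl
    rw [h3] at h2
    have hγp : ∀ i, HasDerivWithinAt (fun s => (γ s).2.2 i)
        (((t • contactField H) (γ s)).2.2 i) (Icc 0 1) s := hasDerivWithinAt_pi.1 h1.snd.snd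
    have hηx : ∀ i, HasDerivWithinAt (fun s => (η s).1 i)
        ((t • fderiv ℝ (contactField H) (γ s) (η s)).1 i) (Icc 0 1) s :=
      hasDerivWithinAt_pi.1 h2.fst
    have hηu : HasDerivWithinAt (fun s => (η s).2.1)
        (t • fderiv ℝ (contactField H) (γ s) (η s)).2.1 (Icc 0 1) s := h2.snd.fst
    have h4 := hηu.fun_sub (HasDerivWithinAt.fun_sum (u := Finset.univ) fun i _ =>
      (hγp i).fun_mul (hηx i))
    refine h4.congr_deriv ?_
    rw [haγ s hs, fderiv_contactField hH, fderiv_apply_eq_sum]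
    simp only [f, contactForm, contactField, Pi.smul_apply, Prod.smul_fst, Prod.smul_snd,
      smul_eq_mul]
    simp only [mul_add, add_mul, mul_sub, neg_mul, mul_neg, Finset.mul_sum,
      Finset.sum_add_distrib, Finset.sum_neg_distrib]
    simp only [mul_assoc, mul_comm, mul_left_comm]
    ring
  have hA : ∀ s, HasDerivAt (fun s => ∫ u in (0 : ℝ)..s, a u) (a s) s := fun s =>
    intervalIntegral.integral_hasDerivAt_right (ha.intervalIntegrable _ _)
      (ha.stronglyMeasurableAtFilter _ _) ha.continuousAt
  have hc : ∀ s ∈ Icc (0 : ℝ) 1,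
      HasDerivWithinAt (fun s => Real.exp (-∫ u in (0 : ℝ)..s, a u) * f s) 0 (Icc 0 1) s := by
    intro s hs
    refine ((((hA s).neg.exp).hasDerivWithinAt).fun_mul (hf s hs)).congr_deriv ?_
    simp only [Pi.neg_apply]
    ring
  have hconst := constant_of_derivWithin_zero (fun s hs => (hc s hs).differentiableWithinAt)
    (fun s hs => (hc s (Ico_subset_Icc_self hs)).derivWithin
      (uniqueDiffOn_Icc zero_lt_one s (Ico_subset_Icc_self hs))) 1 (right_mem_Icc.2 zero_le_one)
  simp only [intervalIntegral.integral_same, neg_zero, Real.exp_zero, one_mul] at hconst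
  have h0 : f 0 = contactForm z v := by simp only [f, hγ.1, hη.1]
  rw [← h0, ← hconst, ← mul_assoc, ← Real.exp_add]
  simp [f]

end ContactSplitting

/-! ### Words of exact flows: inverses, domains, contactomorphism property. -/

namespace ContactSplitting

variable {n : ℕ}

theorem contactFlowDefined_iff {H : Jet n → ℝ} {t : ℝ} {z : Jet n} :
    ContactFlowDefined H t z ↔ TimeOne.Defined (t • contactField H) z := flowDefined_iff

theorem contactFlow_eq {H : Jet n → ℝ} (hH : ContDiff ℝ ∞ H) (t : ℝ) :
    contactFlow H t = TimeOne.map (t • contactField H) :=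
  funext fun z => flow_eq ((contDiff_contactField hH).of_le (by simp)) t z

theorem contactFlow_zero {H : Jet n → ℝ} (hH : ContDiff ℝ ∞ H) (z : Jet n) :
    contactFlow H 0 z = z := by
  rw [contactFlow_eq hH, TimeOne.map_zero_smul]

theorem contDiff_smul_contactField {H : Jet n → ℝ} (hH : ContDiff ℝ ∞ H) (t : ℝ) :
    ContDiff ℝ ∞ (t • contactField H) := (contDiff_contactField hH).const_smul t

theorem isOpen_contactFlowDefined {H : Jet n → ℝ} (hH : ContDiff ℝ ∞ H) (t : ℝ) :
    IsOpen {z | ContactFlowDefined H t z} := by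
  simp only [contactFlowDefined_iff]
  exact TimeOne.isOpen_defined ((contDiff_smul_contactField hH t).of_le (by simp))

theorem contDiffOn_contactFlow {H : Jet n → ℝ} (hH : ContDiff ℝ ∞ H) (t : ℝ) :
    ContDiffOn ℝ ∞ (contactFlow H t) {z | ContactFlowDefined H t z} := by
  simp only [contactFlowDefined_iff, contactFlow_eq hH]
  exact TimeOne.contDiffOn_map (contDiff_smul_contactField hH t)

theorem contactFlow_neg {H : Jet n → ℝ} (hH : ContDiff ℝ ∞ H) {t : ℝ} {z : Jet n}
    (hz : ContactFlowDefined H t z) :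
    ContactFlowDefined H (-t) (contactFlow H t z) ∧ contactFlow H (-t) (contactFlow H t z) = z := by
  simp only [contactFlowDefined_iff, contactFlow_eq hH, neg_smul] at hz ⊢
  exact TimeOne.defined_neg_map ((contDiff_smul_contactField hH t).of_le (by simp)) hz

theorem eventually_contactFlowDefined {H : Jet n → ℝ} (hH : ContDiff ℝ ∞ H) (z : Jet n) :
    ∀ᶠ y in 𝓝 ((0 : ℝ), z), ContactFlowDefined H y.1 y.2 := by
  simp only [contactFlowDefined_iff]
  exact (TimeOne.isOpen_flowDomain (contDiff_contactField hH)).mem_nhds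
    (TimeOne.defined_zero_smul _ z)

theorem contDiffAt_contactFlow {H : Jet n → ℝ} (hH : ContDiff ℝ ∞ H) (z : Jet n) :
    ContDiffAt ℝ ∞ (fun y : ℝ × Jet n => contactFlow H y.1 y.2) (0, z) := by
  simp only [contactFlow_eq hH]
  exact (TimeOne.contDiffOn_flow (contDiff_contactField hH)).contDiffAt
    ((TimeOne.isOpen_flowDomain (contDiff_contactField hH)).mem_nhds
      (TimeOne.defined_zero_smul _ z))

theorem splittingMap_append (w w' : List (Factor n)) (h : ℝ) (z : Jet n) :
    splittingMap (w ++ w') h z = splittingMap w' h (splittingMap w h z) := by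
  induction w generalizing z with
  | nil => rfl
  | cons F w ih => exact ih _

theorem splittingDefined_append (w w' : List (Factor n)) (h : ℝ) (z : Jet n) :
    SplittingDefined (w ++ w') h z ↔
      SplittingDefined w h z ∧ SplittingDefined w' h (splittingMap w h z) := by
  induction w generalizing z with
  | nil => simp [SplittingDefined, splittingMap]
  | cons F w ih => simp [SplittingDefined, splittingMap, ih, and_assoc]

/-- The factor running the same flow backwards. -/
def Factor.inv (F : Factor n) : Factor n := ⟨F.ham, F.sqrtScaled, -F.cPos, -F.cNeg⟩

theorem Factor.time_inv (F : Factor n) (h : ℝ) : F.inv.time h = -F.time h := by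
  by_cases h0 : 0 ≤ h <;> by_cases h1 : F.sqrtScaled = true <;>
    simp [Factor.time, Factor.inv, h0, h1]

/-- The word whose composition of flows inverts that of `w`. -/
def invWord (w : List (Factor n)) : List (Factor n) := (w.map Factor.inv).reverse

theorem invWord_cons (F : Factor n) (w : List (Factor n)) :
    invWord (F :: w) = invWord w ++ [F.inv] := by simp [invWord]

theorem invWord_invWord (w : List (Factor n)) : invWord (invWord w) = w := by
  have h : (Factor.inv ∘ Factor.inv : Factor n → Factor n) = id := by
    funext F
    simp [Factor.inv]
  simp [invWord, h]

/-- All Hamiltonians of the word are smooth. -/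
def SmoothWord (w : List (Factor n)) : Prop := ∀ F ∈ w, ContDiff ℝ ∞ F.ham

theorem SmoothWord.invWord {w : List (Factor n)} (hw : SmoothWord w) :
    SmoothWord (invWord w) := by
  intro F hF
  simp only [ContactSplitting.invWord, List.mem_reverse, List.mem_map] at hF
  obtain ⟨F', hF', rfl⟩ := hF
  exact hw F' hF'

theorem splittingMap_invWord {w : List (Factor n)} (hw : SmoothWord w) {h : ℝ} {z : Jet n}
    (hz : SplittingDefined w h z) :
    SplittingDefined (invWord w) h (splittingMap w h z) ∧
      splittingMap (invWord w) h (splittingMap w h z) = z := by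
  induction w generalizing z with
  | nil => exact ⟨trivial, rfl⟩
  | cons F w ih =>
    have hF : ContDiff ℝ ∞ F.ham := hw F (by simp)
    obtain ⟨h1, h2⟩ := ih (fun F' hF' => hw F' (by simp [hF'])) hz.2
    obtain ⟨h3, h4⟩ := contactFlow_neg hF hz.1
    rw [← F.time_inv] at h3 h4
    rw [invWord_cons, splittingDefined_append, splittingMap_append]
    simp only [splittingMap, h2]
    exact ⟨⟨h1, h3, trivial⟩, h4⟩

theorem isOpen_splittingDefined {w : List (Factor n)} (hw : SmoothWord w) (h : ℝ) :
    IsOpen {z | SplittingDefined w h z} ∧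
      ContDiffOn ℝ ∞ (splittingMap w h) {z | SplittingDefined w h z} := by
  induction w with
  | nil => exact ⟨by simp [SplittingDefined], contDiff_id.contDiffOn⟩
  | cons F w ih =>
    have hF : ContDiff ℝ ∞ F.ham := hw F (by simp)
    obtain ⟨h1, h2⟩ := ih fun F' hF' => hw F' (by simp [hF'])
    have h3 := contDiffOn_contactFlow hF (F.time h)
    exact ⟨h3.continuousOn.isOpen_inter_preimage (isOpen_contactFlowDefined hF _) h1,
      h2.comp (h3.mono fun z hz => hz.1) fun z hz => hz.2⟩

theorem exists_contactForm_splittingMap {w : List (Factor n)} (hw : SmoothWord w) {h : ℝ}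
    {z : Jet n} (hz : SplittingDefined w h z) :
    ∃ l : ℝ, ∀ v, contactForm (splittingMap w h z) (fderiv ℝ (splittingMap w h) z v) =
      Real.exp l * contactForm z v := by
  induction w generalizing z with
  | nil =>
    refine ⟨0, fun v => ?_⟩
    have : fderiv ℝ (splittingMap ([] : List (Factor n)) h) z = ContinuousLinearMap.id ℝ _ :=
      fderiv_id
    rw [this]
    simp [splittingMap]
  | cons F w ih =>
    have hF : ContDiff ℝ ∞ F.ham := hw F (by simp)
    have hw' : SmoothWord w := fun F' hF' => hw F' (by simp [hF'])
    obtain ⟨l, hl⟩ := ih hw' hz.2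
    obtain ⟨l', hl'⟩ := exists_contactForm_fderiv hF (F.time h) (contactFlowDefined_iff.1 hz.1)
    rw [← contactFlow_eq hF] at hl'
    refine ⟨l + l', fun v => ?_⟩
    have h1 : DifferentiableAt ℝ (contactFlow F.ham (F.time h)) z :=
      ((contDiffOn_contactFlow hF _).contDiffAt
        ((isOpen_contactFlowDefined hF _).mem_nhds hz.1)).differentiableAt (by simp)
    have h2 : DifferentiableAt ℝ (splittingMap w h) (contactFlow F.ham (F.time h) z) :=
      ((isOpen_splittingDefined hw' h).2.contDiffAt
        ((isOpen_splittingDefined hw' h).1.mem_nhds hz.2)).differentiableAt (by simp)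
    have h3 : fderiv ℝ (splittingMap (F :: w) h) z = _ := fderiv_comp z h2 h1
    rw [h3, Real.exp_add, mul_assoc, ← hl', ← hl]
    rfl

/-- A composition of contact flows is a contactomorphism on every open set on which it is
defined. -/
theorem isContactomorphismOn_splittingMap {w : List (Factor n)} (hw : SmoothWord w) {h : ℝ}
    {V : Set (Jet n)} (hV : IsOpen V) (hVw : ∀ z ∈ V, SplittingDefined w h z) :
    IsContactomorphismOn (splittingMap w h) V := by
  obtain ⟨hD, hsm⟩ := isOpen_splittingDefined hw h
  obtain ⟨hD', hsm'⟩ := isOpen_splittingDefined hw.invWord h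
  -- Describing the image through the inverse word exhibits it as a preimage under a continuous map
  -- on an open domain, hence as open.
  have himage : splittingMap w h '' V =
      {y | SplittingDefined (invWord w) h y} ∩ splittingMap (invWord w) h ⁻¹' V := by
    ext y
    constructor
    · rintro ⟨z, hz, rfl⟩
      obtain ⟨h1, h2⟩ := splittingMap_invWord hw (hVw z hz)
      exact ⟨h1, by rwa [mem_preimage, h2]⟩
    · rintro ⟨hy, hyV⟩
      have h2 := (splittingMap_invWord hw.invWord hy).2
      rw [invWord_invWord] at h2
      exact ⟨_, hyV, h2⟩
  refine ⟨hV, ?_, hsm.mono hVw, ⟨splittingMap (invWord w) h, ?_, fun z hz =>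
    (splittingMap_invWord hw (hVw z hz)).2⟩, ?_⟩
  · rw [himage]
    exact hsm'.continuousOn.isOpen_inter_preimage hD' hV
  · rw [himage]
    exact hsm'.mono inter_subset_left
  · choose! l hl using fun z (hz : z ∈ V) => exists_contactForm_splittingMap hw (hVw z hz)
    exact ⟨l, hl⟩

theorem Factor.tendsto_time (F : Factor n) : Filter.Tendsto F.time (𝓝 0) (𝓝 0) := by
  have hb : ∀ h, |F.time h| ≤ (|F.cPos| + |F.cNeg|) * (√|h| + |h|) := fun h => by
    rw [Factor.time, abs_mul]
    refine mul_le_mul ?_ ?_ (abs_nonneg _) (by positivity)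
    · split_ifs
      · linarith [abs_nonneg F.cNeg]
      · linarith [abs_nonneg F.cPos]
    · split_ifs
      · rw [abs_of_nonneg (Real.sqrt_nonneg _)]
        linarith [abs_nonneg h]
      · rw [abs_abs]
        linarith [Real.sqrt_nonneg |h|]
  have hc : Continuous fun h : ℝ => (|F.cPos| + |F.cNeg|) * (√|h| + |h|) := by fun_prop
  refine squeeze_zero_norm hb ?_
  simpa using hc.tendsto 0

/-- For small step sizes the composition of flows is defined near every given point. -/
theorem eventually_splittingDefined {w : List (Factor n)} (hw : SmoothWord w) (z : Jet n) :
    ∀ᶠ y in 𝓝 ((0 : ℝ), z), SplittingDefined w y.1 y.2 := by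
  induction w with
  | nil => exact .of_forall fun _ => trivial
  | cons F w ih =>
    have hF : ContDiff ℝ ∞ F.ham := hw F (by simp)
    have hw' : SmoothWord w := fun F' hF' => hw F' (by simp [hF'])
    have h1 : Filter.Tendsto (fun y : ℝ × Jet n => (F.time y.1, y.2)) (𝓝 (0, z)) (𝓝 (0, z)) :=
      (F.tendsto_time.comp (continuous_fst.tendsto ((0 : ℝ), z))).prodMk_nhds continuousAt_snd
    have h2 : Filter.Tendsto (fun y : ℝ × Jet n => contactFlow F.ham (F.time y.1) y.2)
        (𝓝 (0, z)) (𝓝 z) := by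
      have := (contDiffAt_contactFlow hF z).continuousAt.tendsto.comp h1
      simpa [contactFlow_zero hF, Function.comp_def] using this
    have h3 : Filter.Tendsto
        (fun y : ℝ × Jet n => (y.1, contactFlow F.ham (F.time y.1) y.2)) (𝓝 (0, z)) (𝓝 (0, z)) :=
      continuousAt_fst.tendsto.prodMk_nhds h2
    filter_upwards [h1.eventually (eventually_contactFlowDefined hF z), h3.eventually (ih hw')]
      with y hy hy' using ⟨hy, hy'⟩

end ContactSplitting

/-! ### Words as smooth families in `τ`, and the raising of their order. -/

open SmoothFamily

namespace ContactSplitting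

variable {n : ℕ}

/-- The time of a factor at step size `h = τ²`, continued polynomially to all real `τ`. -/
def Factor.polyTime (F : Factor n) (τ : ℝ) : ℝ := F.cPos * (if F.sqrtScaled then τ else τ ^ 2)

/-- The family of maps `τ ↦ Φ^{time(τ)}` of a factor. -/
def Factor.family (F : Factor n) (y : ℝ × Jet n) : Jet n :=
  contactFlow F.ham (F.polyTime y.1) y.2

/-- The composition of the factors of a word as a smooth family in `τ`. -/
def wordFamily : List (Factor n) → ℝ × Jet n → Jet n
  | [] => fun y => y.2
  | F :: w => compose (wordFamily w) F.family

theorem Factor.contDiff_polyTime (F : Factor n) : ContDiff ℝ ∞ F.polyTime := by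
  unfold Factor.polyTime
  split_ifs <;> fun_prop

theorem Factor.polyTime_zero (F : Factor n) : F.polyTime 0 = 0 := by simp [Factor.polyTime]

theorem smooth_contactFlow_comp {H : Jet n → ℝ} (hH : ContDiff ℝ ∞ H) {t : ℝ → ℝ}
    (ht : ContDiff ℝ ∞ t) (h0 : t 0 = 0) :
    NearId (fun y : ℝ × Jet n => contactFlow H (t y.1) y.2) := by
  refine ⟨fun z => ?_, fun z => by simp only [h0, contactFlow_zero hH]⟩
  refine ContDiffAt.comp (g := fun y : ℝ × Jet n => contactFlow H y.1 y.2)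
    (f := fun y : ℝ × Jet n => (t y.1, y.2)) (0, z) ?_ (by fun_prop)
  simpa [h0] using contDiffAt_contactFlow hH z

theorem Factor.nearId_family {F : Factor n} (hF : ContDiff ℝ ∞ F.ham) : NearId F.family :=
  smooth_contactFlow_comp hF F.contDiff_polyTime F.polyTime_zero

theorem Factor.family_inv {F : Factor n} (hF : ContDiff ℝ ∞ F.ham) :
    GermEq (compose F.inv.family F.family) (fun y => y.2) := by
  intro z
  have h1 : ContinuousAt (fun y : ℝ × Jet n => (F.polyTime y.1, y.2)) (0, z) :=
    ((F.contDiff_polyTime.continuous.comp continuous_fst).prodMk continuous_snd).continuousAt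
  have h2 := h1.eventually (p := fun y => ContactFlowDefined F.ham y.1 y.2)
    (by simpa [F.polyTime_zero] using eventually_contactFlowDefined hF z)
  refine h2.mono fun y hy => ?_
  have h3 : F.inv.polyTime y.1 = -F.polyTime y.1 := neg_mul F.cPos _
  simp only [compose, Factor.family, h3]
  exact (contactFlow_neg hF hy).2

theorem nearId_wordFamily {w : List (Factor n)} (hw : SmoothWord w) : NearId (wordFamily w) := by
  induction w with
  | nil => exact ⟨smooth_snd, fun _ => rfl⟩
  | cons F w ih =>
    exact (ih fun F' hF' => hw F' (by simp [hF'])).comp (F.nearId_family (hw F (by simp)))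

theorem wordFamily_append (w w' : List (Factor n)) :
    wordFamily (w ++ w') = compose (wordFamily w') (wordFamily w) := by
  induction w with
  | nil => rfl
  | cons F w ih =>
    simp only [List.cons_append, wordFamily, ih]
    rfl

theorem wordFamily_invWord {w : List (Factor n)} (hw : SmoothWord w) :
    GermEq (compose (wordFamily (invWord w)) (wordFamily w)) (fun y => y.2) := by
  induction w with
  | nil => exact fun z => .of_forall fun y => rfl
  | cons F w ih =>
    have hF : ContDiff ℝ ∞ F.ham := hw F (by simp)
    have h1 := (ih fun F' hF' => hw F' (by simp [hF'])).comp_left (F.nearId_family hF).1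
    intro z
    filter_upwards [h1 z, Factor.family_inv hF z] with y hy hy'
    rw [invWord_cons, wordFamily_append]
    simp only [compose, wordFamily] at hy hy' ⊢
    rw [hy, hy']

/-- Rescaling of all coefficients, corresponding to `τ ↦ aτ`. -/
def scaleWord (a : ℝ) (w : List (Factor n)) : List (Factor n) :=
  -- `wordFamily` sees only `cPos`, so the value kept in `cNeg` is immaterial.
  w.map fun F => ⟨F.ham, F.sqrtScaled, F.cPos * (if F.sqrtScaled then a else a ^ 2), F.cNeg⟩

theorem wordFamily_scaleWord (a : ℝ) (w : List (Factor n)) (y : ℝ × Jet n) :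
    wordFamily (scaleWord a w) y = wordFamily w (a * y.1, y.2) := by
  induction w generalizing y with
  | nil => rfl
  | cons F w ih =>
    simp only [scaleWord, List.map_cons, wordFamily, compose] at ih ⊢
    rw [ih]
    simp only [Factor.family, Factor.polyTime]
    congr 3
    split_ifs <;> ring

/-- The exact flow at time `cτ²`. -/
def quadFlow (H : Jet n → ℝ) (c : ℝ) (y : ℝ × Jet n) : Jet n := contactFlow H (c * y.1 ^ 2) y.2

theorem nearId_quadFlow {H : Jet n → ℝ} (hH : ContDiff ℝ ∞ H) (c : ℝ) : NearId (quadFlow H c) :=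
  smooth_contactFlow_comp hH (t := fun τ => c * τ ^ 2) (by fun_prop) (by simp)

theorem quadFlow_compose {H : Jet n → ℝ} (hH : ContDiff ℝ ∞ H) (c c' : ℝ) :
    GermEq (compose (quadFlow H c) (quadFlow H c')) (quadFlow H (c + c')) := by
  intro z
  obtain ⟨ε, hε, hev⟩ :=
    TimeOne.eventually_flow_add ((contDiff_contactField hH).of_le (by simp)) z
  have h1 : ∀ᶠ y : ℝ × Jet n in 𝓝 (0, z), |c' * y.1 ^ 2| + |c * y.1 ^ 2| < ε := by
    have hc : Continuous fun y : ℝ × Jet n => |c' * y.1 ^ 2| + |c * y.1 ^ 2| := by fun_prop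
    exact hc.continuousAt.eventually (p := fun t => t < ε) (Iio_mem_nhds (by simpa using hε))
  filter_upwards [h1, (continuous_snd.tendsto ((0 : ℝ), z)).eventually hev] with y hy hy'
  simp only [compose, quadFlow, contactFlow_eq hH]
  rw [hy' _ _ hy]
  congr 2
  ring

theorem quadFlow_zero {H : Jet n → ℝ} (hH : ContDiff ℝ ∞ H) (y : ℝ × Jet n) :
    quadFlow H 0 y = y.2 := by
  simp [quadFlow, contactFlow_zero hH]

theorem hasDerivAt_contactFlow_zero {H : Jet n → ℝ} (hH : ContDiff ℝ ∞ H) (z : Jet n) :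
    HasDerivAt (fun t => contactFlow H t z) (contactField H z) 0 := by
  simp only [contactFlow_eq hH]
  exact TimeOne.hasDerivAt_flow_zero ((contDiff_contactField hH).of_le (by simp)) z

theorem quadFlow_congrMod {H : Jet n → ℝ} (hH : ContDiff ℝ ∞ H) :
    CongrMod 3 (quadFlow H 1) (fun y => y.2 + y.1 ^ 2 • contactField H y.2) := by
  obtain ⟨R, hR, h⟩ := congrMod_two (f := fun y : ℝ × Jet n => contactFlow H y.1 y.2)
    (fun z => contDiffAt_contactFlow hH z) (hasDerivAt_contactFlow_zero hH)
  have hc : ∀ z, ContDiffAt ℝ ∞ (fun y : ℝ × Jet n => (y.1 ^ 2, y.2)) (0, z) :=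
    fun z => by fun_prop
  -- The Taylor remainder is quadratic in the time `τ²`, that is `τ⁴ R`; the spare factor `τ` joins
  -- the remainder.
  refine ⟨fun y => y.1 • R (y.1 ^ 2, y.2), fun z => ?_, fun z => ?_⟩
  · refine contDiffAt_fst.smul (ContDiffAt.comp (g := R) _ ?_ (hc z))
    simpa using hR z
  · have h1 := (hc z).continuousAt.eventually (p := fun y => contactFlow H y.1 y.2 =
      (contactFlow H 0 y.2 + y.1 • contactField H y.2) + y.1 ^ 2 • R y) (by simpa using h z)
    refine h1.mono fun y hy => ?_
    simp only [quadFlow, one_mul]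
    rw [hy, contactFlow_zero hH, smul_smul]
    congr 2
    ring

section Construction

variable (P : (Jet n → ℝ) → Prop)

/-- The word only uses Hamiltonians satisfying `P` and its family is `z + τ² e(z)` up to `τ³`. -/
def Realizes (e : Jet n → Jet n) : Prop :=
  ∃ w : List (Factor n), (∀ F ∈ w, P F.ham) ∧
    CongrMod 3 (wordFamily w) (fun y => y.2 + y.1 ^ 2 • e y.2)

variable {P}

theorem realizes_zero : Realizes P (fun _ : Jet n => 0) :=
  ⟨[], by simp, congrMod_of_eq (fun y => by simp [wordFamily]) 3⟩

theorem Realizes.add {e e' : Jet n → Jet n} (he : ContDiff ℝ ∞ e) (he' : ContDiff ℝ ∞ e')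
    (h : Realizes P e) (h' : Realizes P e') : Realizes P (fun z => e z + e' z) := by
  obtain ⟨w, hw, hc⟩ := h
  obtain ⟨w', hw', hc'⟩ := h'
  refine ⟨w' ++ w, fun F hF => (List.mem_append.1 hF).elim (hw' F) (hw F), ?_⟩
  rw [wordFamily_append]
  have hid : NearId (fun y : ℝ × Jet n => y.2) := ⟨smooth_snd, fun _ => rfl⟩
  exact CongrMod.comp_expansion two_ne_zero hid hid he he' hc hc'

theorem realizes_contactField {H : Jet n → ℝ} (hH : ContDiff ℝ ∞ H) (hP : P H) :
    Realizes P (contactField H) := by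
  refine ⟨[⟨H, false, 1, 0⟩], by simpa using hP, ?_⟩
  refine (congrMod_of_eq (fun y => ?_) 3).trans (quadFlow_congrMod hH)
  simp [wordFamily, compose, Factor.family, Factor.polyTime, quadFlow]

/-- A commutator of flows run for times `±τ`. The head of the word acts first, so the map is `Φ_K⁻¹
∘ Φ_H⁻¹ ∘ Φ_K ∘ Φ_H`, whose leading term `DX_K(X_H) - DX_H(X_K)` is the field of `jacobi H K` with
the right sign. -/
theorem realizes_jacobi {H K : Jet n → ℝ} (hH : ContDiff ℝ ∞ H) (hK : ContDiff ℝ ∞ K)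
    (hPH : P H) (hPK : P K) : Realizes P (contactField (jacobi H K)) := by
  let FH : Factor n := ⟨H, true, 1, 0⟩
  let FK : Factor n := ⟨K, true, 1, 0⟩
  have hder : ∀ F : Factor n, ContDiff ℝ ∞ F.ham → F.sqrtScaled = true → F.cPos = 1 →
      ∀ z, HasDerivAt (fun τ => F.family (τ, z)) (contactField F.ham z) 0 := fun F hF h1 h2 z => by
    simpa [Factor.family, Factor.polyTime, h1, h2] using hasDerivAt_contactFlow_zero hF z
  refine ⟨[FH, FK, FH.inv, FK.inv], ?_, ?_⟩
  · simp [FH, FK, Factor.inv, hPH, hPK]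
  · have h := commutator_expansion (contDiff_contactField hK) (contDiff_contactField hH)
      (FK.nearId_family hK) (FH.nearId_family hH)
      (Factor.nearId_family (F := FK.inv) hK).1 (Factor.nearId_family (F := FH.inv) hH).1
      (hder FK hK rfl rfl) (hder FH hH rfl rfl) (FK.family_inv hK) (FH.family_inv hH)
    refine (congrMod_of_eq (fun y => rfl) 3).trans
      (h.trans (congrMod_of_eq (fun y => ?_) 3))
    rw [contactField_jacobi hH hK]

theorem Realizes.sum {ι : Type*} (t : Finset ι) {e : ι → Jet n → Jet n}
    (he : ∀ i, ContDiff ℝ ∞ (e i)) (h : ∀ i, Realizes P (e i)) :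
    Realizes P (fun z => ∑ i ∈ t, e i z) := by
  classical
  induction t using Finset.induction_on with
  | empty => simpa using realizes_zero
  | insert a t ha ih =>
    simp only [Finset.sum_insert ha]
    exact (h a).add (he a) (ContDiff.sum fun i _ => he i) ih

/-- Take `b = θ a` with `θ = 2^{1/p}`; the remaining condition is `(2 - θ²) a² = 1`. It is solvable
because `θ² < 2`, which is where `p > 2` enters. -/
theorem exists_order_coefficients {p : ℕ} (hp : 3 ≤ p) :
    ∃ a b : ℝ, 2 * a ^ 2 - b ^ 2 = 1 ∧ 2 * a ^ p = b ^ p := by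
  obtain ⟨θ, hθ0, hθ⟩ : ∃ θ : ℝ, 0 ≤ θ ∧ θ ^ p = 2 :=
    ⟨(2 : ℝ) ^ ((p : ℝ)⁻¹), by positivity, Real.rpow_inv_natCast_pow (by norm_num) (by omega)⟩
  have hθ2 : θ ^ 2 < 2 := by
    by_contra! hge
    have h1 : 1 < θ := by nlinarith
    have h2 : θ ^ 3 ≤ θ ^ p := pow_le_pow_right₀ h1.le hp
    nlinarith
  have hpos : 0 < 2 - θ ^ 2 := by linarith
  have hsq : (√(2 - θ ^ 2))⁻¹ ^ 2 = (2 - θ ^ 2)⁻¹ := by rw [inv_pow, Real.sq_sqrt hpos.le]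
  refine ⟨(√(2 - θ ^ 2))⁻¹, θ * (√(2 - θ ^ 2))⁻¹, ?_, ?_⟩
  · rw [mul_pow, hsq, ← sub_mul, mul_inv_cancel₀ hpos.ne']
  · rw [mul_pow, hθ]

/-- Composition of rescaled copies of a method raises its order. -/
theorem exists_word_succ (hPs : ∀ H, P H → ContDiff ℝ ∞ H) {H : Jet n → ℝ} (hH : ContDiff ℝ ∞ H)
    {p : ℕ} (hp : 3 ≤ p) {w : List (Factor n)} (hw : ∀ F ∈ w, P F.ham)
    (hc : CongrMod p (wordFamily w) (quadFlow H 1)) :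
    ∃ w' : List (Factor n), (∀ F ∈ w', P F.ham) ∧
      CongrMod (p + 1) (wordFamily w') (quadFlow H 1) := by
  obtain ⟨e, he, hce⟩ := hc.exists_coeff
  have hp0 : p ≠ 0 := by omega
  have hscale : ∀ a : ℝ, CongrMod (p + 1) (wordFamily (scaleWord a w))
      (fun y => quadFlow H (a ^ 2) y + y.1 ^ p • (a ^ p • e y.2)) := fun a => by
    refine (congrMod_of_eq (wordFamily_scaleWord a w) _).trans ((hce.rescale a).trans
      (congrMod_of_eq (fun y => ?_) _))
    simp only [quadFlow, mul_pow, smul_smul, one_mul]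
    rw [mul_comm (y.1 ^ p)]
  have hPscale : ∀ a : ℝ, ∀ F ∈ scaleWord a w, P F.ham := fun a F hF => by
    simp only [scaleWord, List.mem_map] at hF
    obtain ⟨F', hF', rfl⟩ := hF
    exact hw F' hF'
  have hPinv : ∀ v : List (Factor n), (∀ F ∈ v, P F.ham) → ∀ F ∈ invWord v, P F.ham :=
    fun v hv F hF => by
      simp only [invWord, List.mem_reverse, List.mem_map] at hF
      obtain ⟨F', hF', rfl⟩ := hF
      exact hv F' hF'
  obtain ⟨a, b, hab, habp⟩ : ∃ a b : ℝ, 2 * a ^ 2 - b ^ 2 = 1 ∧ 2 * a ^ p = b ^ p :=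
    exists_order_coefficients hp
  have hsm : ∀ a, SmoothWord (scaleWord a w) := fun a F hF => hPs _ (hPscale a F hF)
  have hea : ∀ c : ℝ, ContDiff ℝ ∞ fun z => c • e z := fun c => he.const_smul c
  -- The flow time is quadratic in `τ`, so no real rescaling of `τ` reverses it; the backward
  -- substep has to come from the inverse word.
  have hinv : CongrMod (p + 1) (wordFamily (invWord (scaleWord b w)))
      (fun y => quadFlow H (-b ^ 2) y + y.1 ^ p • (-(b ^ p • e y.2))) := by
    refine CongrMod.inverse_expansion (S := quadFlow H (b ^ 2)) (S' := quadFlow H (-b ^ 2))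
      (e := fun z => b ^ p • e z) hp0 (nearId_quadFlow hH _) (nearId_quadFlow hH _)
      (hea (b ^ p)) (hscale b) (fun z => ?_) (nearId_wordFamily (hsm b).invWord).1
      (wordFamily_invWord (hsm b))
    refine (quadFlow_compose hH (b ^ 2) (-b ^ 2) z).mono fun y hy => ?_
    rw [hy, add_neg_cancel, quadFlow_zero hH]
  have hdouble := CongrMod.comp_expansion (e := fun z => a ^ p • e z)
    (e' := fun z => a ^ p • e z) hp0 (nearId_quadFlow hH _) (nearId_quadFlow hH _)
    (hea (a ^ p)) (hea (a ^ p)) (hscale a) (hscale a)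
  have htotal := CongrMod.comp_expansion (e := fun z => -(b ^ p • e z))
    (e' := fun z => a ^ p • e z + a ^ p • e z) hp0 (nearId_quadFlow hH (-b ^ 2))
    ((nearId_quadFlow hH (a ^ 2)).comp (nearId_quadFlow hH (a ^ 2)))
    (hea (b ^ p)).neg ((hea (a ^ p)).add (hea (a ^ p))) hinv hdouble
  refine ⟨(scaleWord a w ++ scaleWord a w) ++ invWord (scaleWord b w), fun F hF => ?_, ?_⟩
  · rcases List.mem_append.1 hF with h | h
    · exact (List.mem_append.1 h).elim (hPscale a F) (hPscale a F)
    · exact hPinv _ (hPscale b) F h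
  · rw [wordFamily_append, wordFamily_append]
    refine htotal.trans (GermEq.congrMod (fun z => ?_) _)
    have h1 := quadFlow_compose hH (a ^ 2) (a ^ 2) z
    have h2 := quadFlow_compose hH (-b ^ 2) (a ^ 2 + a ^ 2) z
    filter_upwards [h1, h2] with y hy hy'
    have h3 : -(b ^ p • e y.2) + (a ^ p • e y.2 + a ^ p • e y.2) = 0 := by
      rw [← habp]
      module
    have h4 : -b ^ 2 + (a ^ 2 + a ^ 2) = 1 := by linarith
    rw [h3, smul_zero, add_zero]
    rw [h4] at hy'
    rw [← hy']
    simp only [compose] at hy ⊢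
    rw [hy]

end Construction

end ContactSplitting

/-! ### From congruences to uniform bounds on derivatives. -/

namespace SmoothFamily

variable {E F : Type u} [NormedAddCommGroup E] [NormedSpace ℝ E]
  [NormedAddCommGroup F] [NormedSpace ℝ F]

/-- Differentiation in the space variable alone preserves joint smoothness, so these derivatives are
locally bounded uniformly in small `τ`. -/
theorem contDiffAt_iteratedFDeriv_slice {R : ℝ × E → F} {z : E} (hR : ContDiffAt ℝ ∞ R (0, z))
    (j : ℕ) :
    ContDiffAt ℝ ∞ (fun y : ℝ × E => iteratedFDeriv ℝ j (fun x => R (y.1, x)) y.2) (0, z) := by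
  induction j with
  | zero =>
    simp only [iteratedFDeriv_zero_eq_comp]
    exact ((continuousMultilinearCurryFin0 ℝ E F).symm.contDiff.contDiffAt).comp _ hR
  | succ j ih =>
    simp only [iteratedFDeriv_succ_eq_comp_left]
    have h1 : ContDiffAt ℝ ∞ (fun y : ℝ × E =>
        fderiv ℝ (iteratedFDeriv ℝ j fun x => R (y.1, x)) y.2) (0, z) := by
      refine ContDiffAt.fderiv
        (f := fun (y : ℝ × E) x => iteratedFDeriv ℝ j (fun x => R (y.1, x)) x)
        (g := fun y : ℝ × E => y.2) (n := ∞) ?_ contDiffAt_snd (by simp)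
      exact ContDiffAt.comp
        (g := fun y : ℝ × E => iteratedFDeriv ℝ j (fun x => R (y.1, x)) y.2)
        (f := fun q : (ℝ × E) × E => (q.1.1, q.2)) ((0, z), z) ih (by fun_prop)
    exact h1.continuousLinearMap_comp ((continuousMultilinearCurryLeftEquiv ℝ
      (fun _ : Fin (j + 1) => E) F).symm : _ →L[ℝ] E [×(j + 1)]→L[ℝ] F)

/-- Families congruent modulo `τ ^ p` are `O(τ ^ p)`-close with all derivatives, uniformly on
compact sets. -/
theorem CongrMod.exists_bound {p : ℕ} {f g : ℝ × E → F} (h : CongrMod p f g) {U : Set E}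
    (hU : IsCompact U) (j : ℕ) :
    ∃ C : ℝ, ∀ᶠ τ in 𝓝 (0 : ℝ), ∀ z ∈ U,
      ‖iteratedFDeriv ℝ j (fun x => f (τ, x) - g (τ, x)) z‖ ≤ C * |τ| ^ p := by
  obtain ⟨R, hR, h⟩ := h
  -- The property passes to subsets and to unions of two sets, so it only has to hold near each
  -- point.
  refine hU.induction_on (p := fun s => ∃ C : ℝ, ∀ᶠ τ in 𝓝 (0 : ℝ), ∀ z ∈ s,
      ‖iteratedFDeriv ℝ j (fun x => f (τ, x) - g (τ, x)) z‖ ≤ C * |τ| ^ p) ?_ ?_ ?_ ?_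
  · exact ⟨0, by simp⟩
  · rintro s t hst ⟨C, hC⟩
    exact ⟨C, hC.mono fun τ hτ z hz => hτ z (hst hz)⟩
  · rintro s t ⟨C, hC⟩ ⟨C', hC'⟩
    refine ⟨max C C', ?_⟩
    filter_upwards [hC, hC'] with τ h1 h2 z hz
    rcases hz with hz | hz
    · exact (h1 z hz).trans (by gcongr; exact le_max_left _ _)
    · exact (h2 z hz).trans (by gcongr; exact le_max_right _ _)
  · intro z₀ _
    have hcont := (contDiffAt_iteratedFDeriv_slice (hR z₀) j).continuousAt
    have hbdd : ∀ b : ℝ × E → ℝ, ContinuousAt b (0, z₀) →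
        ∃ C : ℝ, ∀ᶠ y in 𝓝 ((0 : ℝ), z₀), b y < C :=
      fun b hb => ⟨b (0, z₀) + 1, hb.eventually_lt_const (lt_add_one _)⟩
    obtain ⟨C, hC⟩ := hbdd _ hcont.norm
    have hsm : ∀ᶠ y in 𝓝 ((0 : ℝ), z₀), ContDiffAt ℝ j R y :=
      ((hR z₀).of_le (mod_cast le_top)).eventually (by simp)
    have hall := (h z₀).eventually_nhds.and (hC.and hsm)
    rw [nhds_prod_eq] at hall
    obtain ⟨pa, hpa, pb, hpb, hab⟩ := Filter.eventually_prod_iff.1 hall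
    refine ⟨{x | pb x}, mem_nhdsWithin_of_mem_nhds hpb, C, ?_⟩
    filter_upwards [hpa] with τ hτ z hz
    obtain ⟨h1, h2, h3⟩ := hab hτ hz
    have heq : (fun x => f (τ, x) - g (τ, x)) =ᶠ[𝓝 z] fun x => τ ^ p • R (τ, x) := by
      have hc : ContinuousAt (fun x : E => (τ, x)) z := by fun_prop
      refine (hc.eventually h1).mono fun x hx => ?_
      simp only
      rw [hx]
      simp
    have hslice : ContDiffAt ℝ j (fun x => R (τ, x)) z :=
      ContDiffAt.comp (g := R) (f := fun x : E => (τ, x)) z h3 (by fun_prop)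
    rw [(Filter.EventuallyEq.iteratedFDeriv ℝ heq j).eq_of_nhds, iteratedFDeriv_const_smul_apply' hslice, norm_smul, norm_pow,
      Real.norm_eq_abs, mul_comm]
    gcongr

end SmoothFamily

/-! ### Both signs of the step size, and the final assembly. -/

namespace ContactSplitting

variable {n : ℕ}

/-- The factor restricted to nonnegative step sizes. -/
def Factor.forward (F : Factor n) : Factor n := ⟨F.ham, F.sqrtScaled, F.cPos, 0⟩

/-- The factor moved to negative step sizes. -/
def Factor.backward (F : Factor n) : Factor n := ⟨F.ham, F.sqrtScaled, 0, F.cPos⟩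

theorem splittingMap_eq_wordFamily {w : List (Factor n)} {φ : Factor n → Factor n} {h : ℝ}
    (hφ : ∀ F ∈ w, (φ F).ham = F.ham ∧ (φ F).time h = F.polyTime √|h|) (z : Jet n) :
    splittingMap (w.map φ) h z = wordFamily w (√|h|, z) := by
  induction w generalizing z with
  | nil => rfl
  | cons F w ih =>
    obtain ⟨h1, h2⟩ := hφ F (by simp)
    simp only [List.map_cons, splittingMap, wordFamily, compose, Factor.family, h1, h2]
    exact ih (fun F' hF' => hφ F' (by simp [hF'])) _

/-- Disposes of the half of a `signedWord` that belongs to the other sign. -/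
theorem splittingMap_of_time_eq_zero {w : List (Factor n)} (hw : SmoothWord w) {h : ℝ}
    (h0 : ∀ F ∈ w, F.time h = 0) (z : Jet n) : splittingMap w h z = z := by
  induction w generalizing z with
  | nil => rfl
  | cons F w ih =>
    simp only [splittingMap]
    rw [h0 F (by simp), contactFlow_zero (hw F (by simp))]
    exact ih (fun F' hF' => hw F' (by simp [hF'])) (fun F' hF' => h0 F' (by simp [hF'])) z

/-- The word that runs `w` for nonnegative and `w'` for negative step sizes. -/
def signedWord (w w' : List (Factor n)) : List (Factor n) :=
  w.map Factor.forward ++ w'.map Factor.backward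

theorem mem_signedWord {w w' : List (Factor n)} {Q : (Jet n → ℝ) → Prop}
    (hw : ∀ F ∈ w, Q F.ham) (hw' : ∀ F ∈ w', Q F.ham) : ∀ F ∈ signedWord w w', Q F.ham := by
  intro F hF
  simp only [signedWord, List.mem_append, List.mem_map] at hF
  rcases hF with ⟨F', hF', rfl⟩ | ⟨F', hF', rfl⟩
  · exact hw F' hF'
  · exact hw' F' hF'

theorem splittingMap_signedWord_of_nonneg {w w' : List (Factor n)} (hw' : SmoothWord w') {h : ℝ}
    (h0 : 0 ≤ h) (z : Jet n) :
    splittingMap (signedWord w w') h z = wordFamily w (√|h|, z) := by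
  rw [signedWord, splittingMap_append,
    splittingMap_eq_wordFamily (φ := Factor.forward) (fun F _ => ⟨rfl, ?_⟩)]
  · refine splittingMap_of_time_eq_zero (fun F hF => ?_) (fun F hF => ?_) _
    · obtain ⟨F', hF', rfl⟩ := List.mem_map.1 hF
      exact hw' F' hF'
    · obtain ⟨F', hF', rfl⟩ := List.mem_map.1 hF
      simp [Factor.time, Factor.backward, h0]
  · simp only [Factor.time, Factor.forward, if_pos h0, Factor.polyTime,
      Real.sq_sqrt (abs_nonneg h)]
    rfl

theorem splittingMap_signedWord_of_neg {w w' : List (Factor n)} (hw : SmoothWord w) {h : ℝ}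
    (h0 : h < 0) (z : Jet n) :
    splittingMap (signedWord w w') h z = wordFamily w' (√|h|, z) := by
  rw [signedWord, splittingMap_append,
    splittingMap_eq_wordFamily (φ := Factor.backward) (fun F _ => ⟨rfl, ?_⟩)]
  · rw [splittingMap_of_time_eq_zero (fun F hF => ?_) (fun F hF => ?_)]
    · obtain ⟨F', hF', rfl⟩ := List.mem_map.1 hF
      exact hw F' hF'
    · obtain ⟨F', hF', rfl⟩ := List.mem_map.1 hF
      simp [Factor.time, Factor.forward, h0.not_ge]
  · simp only [Factor.time, Factor.backward, if_neg h0.not_ge, Factor.polyTime,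
      Real.sq_sqrt (abs_nonneg h)]
    rfl

/-- The induction starts at `τ³`, where both the word and the exact flow are `z + τ² X_H(z)`. -/
theorem exists_word_congrMod {P : (Jet n → ℝ) → Prop} (hPs : ∀ H, P H → ContDiff ℝ ∞ H)
    {H : Jet n → ℝ} (hH : ContDiff ℝ ∞ H) (hR : Realizes P (contactField H)) (q : ℕ) :
    ∃ w : List (Factor n), (∀ F ∈ w, P F.ham) ∧
      CongrMod (q + 3) (wordFamily w) (quadFlow H 1) := by
  induction q with
  | zero =>
    obtain ⟨w, hw, hc⟩ := hR
    exact ⟨w, hw, hc.trans (quadFlow_congrMod hH).symm⟩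
  | succ q ih =>
    obtain ⟨w, hw, hc⟩ := ih
    rw [Nat.add_right_comm]
    exact exists_word_succ hPs hH (by omega) hw hc

theorem contactFlow_eq_quadFlow_of_nonneg (H : Jet n → ℝ) {h : ℝ} (h0 : 0 ≤ h) (z : Jet n) :
    contactFlow H h z = quadFlow H 1 (√|h|, z) := by
  simp [quadFlow, abs_of_nonneg h0, Real.sq_sqrt h0]

theorem contactFlow_eq_quadFlow_of_neg (H : Jet n → ℝ) {h : ℝ} (h0 : h < 0) (z : Jet n) :
    contactFlow H h z = quadFlow H (-1) (√|h|, z) := by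
  simp only [quadFlow]
  rw [Real.sq_sqrt (abs_nonneg h), abs_of_neg h0, neg_one_mul, neg_neg]

/-- High-order splitting for every Hamiltonian whose field is realized to leading order. -/
theorem exists_splitting {P : (Jet n → ℝ) → Prop} (hPs : ∀ H, P H → ContDiff ℝ ∞ H)
    {H : Jet n → ℝ} (hH : ContDiff ℝ ∞ H) (hR : Realizes P (contactField H))
    {U : Set (Jet n)} (hU : IsCompact U) (k : ℕ) :
    ∃ w : List (Factor n), (∀ F ∈ w, P F.ham) ∧
      ∀ r : ℕ, ∃ C : ℝ, ∀ᶠ h in 𝓝 (0 : ℝ),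
        CrNormLE r U (fun z => splittingMap w h z - contactFlow H h z) (C * |h| ^ (k + 1)) := by
  -- With `τ = √|h|` the target `|h| ^ (k + 1)` is `τ ^ (2k + 2)`, which the available order `2k +
  -- 3` covers.
  obtain ⟨w, hw, hc⟩ := exists_word_congrMod hPs hH hR (2 * k)
  have hws : SmoothWord w := fun F hF => hPs _ (hw F hF)
  have hpos : CongrMod (2 * k + 1 + 1) (wordFamily w) (quadFlow H 1) := hc.of_le (by omega)
  -- For `h < 0` the exact flow runs for time `-τ²`, which the inverse word approximates to the same
  -- order. Taking the leading coefficient to be `0` turns `inverse_expansion` into a plain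
  -- congruence.
  have hneg : CongrMod (2 * k + 1 + 1) (wordFamily (invWord w)) (quadFlow H (-1)) := by
    have h1 := CongrMod.inverse_expansion (S := quadFlow H 1) (S' := quadFlow H (-1))
      (e := fun _ => 0) (Nat.succ_ne_zero (2 * k)) (nearId_quadFlow hH _) (nearId_quadFlow hH _)
      contDiff_const (by simpa using hpos) (fun z => ?_) (nearId_wordFamily hws.invWord).1
      (wordFamily_invWord hws)
    · simpa using h1
    · refine (quadFlow_compose hH 1 (-1) z).mono fun y hy => ?_
      rw [hy, add_neg_cancel, quadFlow_zero hH]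
  have hw' : ∀ F ∈ invWord w, P F.ham := fun F hF => by
    simp only [invWord, List.mem_reverse, List.mem_map] at hF
    obtain ⟨F', hF', rfl⟩ := hF
    exact hw F' hF'
  refine ⟨signedWord w (invWord w), mem_signedWord hw hw', fun r => ?_⟩
  choose C hC using fun j => hpos.exists_bound hU j
  choose C' hC' using fun j => hneg.exists_bound hU j
  have hτ : Filter.Tendsto (fun h : ℝ => √|h|) (𝓝 0) (𝓝 0) := by
    have : Continuous fun h : ℝ => √|h| := by fun_prop
    simpa using this.tendsto 0
  have hpow : ∀ h : ℝ, abs √|h| ^ (2 * k + 1 + 1) = |h| ^ (k + 1) := fun h => by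
    rw [abs_of_nonneg (Real.sqrt_nonneg _), show 2 * k + 1 + 1 = 2 * (k + 1) by ring, pow_mul,
      Real.sq_sqrt (abs_nonneg h)]
  let B : ℝ := ∑ j ∈ Finset.range (r + 1), (|C j| + |C' j|)
  have hB : ∀ j ≤ r, |C j| + |C' j| ≤ B := fun j hj =>
    Finset.single_le_sum (f := fun j => |C j| + |C' j|) (fun i _ => by positivity)
      (Finset.mem_range.2 (by omega))
  refine ⟨B, ?_⟩
  have hall : ∀ᶠ h in 𝓝 (0 : ℝ), ∀ j ∈ Finset.range (r + 1),
      (∀ z ∈ U, ‖iteratedFDeriv ℝ j (fun x => wordFamily w (√|h|, x) -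
        quadFlow H 1 (√|h|, x)) z‖ ≤ C j * |h| ^ (k + 1)) ∧
      (∀ z ∈ U, ‖iteratedFDeriv ℝ j (fun x => wordFamily (invWord w) (√|h|, x) -
        quadFlow H (-1) (√|h|, x)) z‖ ≤ C' j * |h| ^ (k + 1)) := by
    refine (Filter.eventually_all_finset _).2 fun j _ => ?_
    filter_upwards [hτ.eventually (hC j), hτ.eventually (hC' j)] with h h1 h2
    simp only [hpow] at h1 h2
    exact ⟨h1, h2⟩
  filter_upwards [hall] with h hh j hj z hz
  obtain ⟨h1, h2⟩ := hh j (Finset.mem_range.2 (by omega))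
  rcases le_or_gt 0 h with h0 | h0
  · simp only [splittingMap_signedWord_of_nonneg hws.invWord h0,
      contactFlow_eq_quadFlow_of_nonneg H h0]
    refine (h1 z hz).trans ?_
    gcongr
    linarith [le_abs_self (C j), abs_nonneg (C' j), hB j hj]
  · simp only [splittingMap_signedWord_of_neg hws h0, contactFlow_eq_quadFlow_of_neg H h0]
    refine (h2 z hz).trans ?_
    gcongr
    linarith [le_abs_self (C' j), abs_nonneg (C j), hB j hj]

/-- Near a compact set, for small step sizes, splitting map and exact flow are defined. -/
theorem exists_common_domain {w : List (Factor n)} (hw : SmoothWord w) {H : Jet n → ℝ}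
    (hH : ContDiff ℝ ∞ H) {U : Set (Jet n)} (hU : IsCompact U) :
    ∃ V : Set (Jet n), IsOpen V ∧ U ⊆ V ∧ ∃ h₀ : ℝ, 0 < h₀ ∧ ∀ h : ℝ, |h| < h₀ →
      ∀ z ∈ V, SplittingDefined w h z ∧ ContactFlowDefined H h z := by
  obtain ⟨u, V, hu, hV, h0u, hUV, huV⟩ := generalized_tube_lemma
    (isCompact_singleton (x := (0 : ℝ))) hU
    (isOpen_interior (s := {y : ℝ × Jet n |
      SplittingDefined w y.1 y.2 ∧ ContactFlowDefined H y.1 y.2})) (by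
      rintro ⟨e, z⟩ ⟨he, -⟩
      obtain rfl : e = 0 := he
      exact mem_interior_iff_mem_nhds.2
        ((eventually_splittingDefined hw z).and (eventually_contactFlowDefined hH z)))
  obtain ⟨h₀, hh₀, hball⟩ := Metric.isOpen_iff.1 hu 0 (h0u rfl)
  refine ⟨V, hV, hUV, h₀, hh₀, fun h hh z hz => ?_⟩
  have hmem : (h, z) ∈ u ×ˢ V := ⟨hball (by simpa using hh), hz⟩
  have := interior_subset (huV hmem)
  exact this

end ContactSplitting

end

theorem mainTheorem3 {n : ℕ} {ι : Type*} [Fintype ι]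
    (s₀ d₀ : ContactSplitting.Jet n → ℝ) (s d : ι → ContactSplitting.Jet n → ℝ)
    (hs₀ : ContactSplitting.IsStrict s₀) (hd₀ : ContactSplitting.IsProlonged d₀)
    (hs : ∀ i, ContactSplitting.IsStrict (s i)) (hd : ∀ i, ContactSplitting.IsProlonged (d i))
    (H : ContactSplitting.Jet n → ℝ)
    (hH : ∀ z, H z = s₀ z + d₀ z + ∑ i, ContactSplitting.jacobi (s i) (d i) z)
    (U : Set (ContactSplitting.Jet n)) (hU : IsCompact U) (k : ℕ) :
    ∃ w : List (ContactSplitting.Factor n),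
      (∀ F ∈ w, F.ham = s₀ ∨ F.ham = d₀ ∨ (∃ i, F.ham = s i) ∨ (∃ i, F.ham = d i)) ∧
      (∃ V : Set (ContactSplitting.Jet n), IsOpen V ∧ U ⊆ V ∧
        ∃ h₀ : ℝ, 0 < h₀ ∧ ∀ h : ℝ, |h| < h₀ →
          (∀ z ∈ V, ContactSplitting.SplittingDefined w h z) ∧
          ContactSplitting.IsContactomorphismOn (ContactSplitting.splittingMap w h) V ∧
          (∀ z ∈ V, ContactSplitting.ContactFlowDefined H h z) ∧
          ContDiffOn ℝ ∞ (ContactSplitting.contactFlow H h) V) ∧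
      ∀ r : ℕ, ∃ C : ℝ, ∀ᶠ h in nhds (0 : ℝ),
        ContactSplitting.CrNormLE r U
          (fun z => ContactSplitting.splittingMap w h z - ContactSplitting.contactFlow H h z)
          (C * |h| ^ (k + 1)) := by
  let P : (ContactSplitting.Jet n → ℝ) → Prop := fun K =>
    K = s₀ ∨ K = d₀ ∨ (∃ i, K = s i) ∨ (∃ i, K = d i)
  have hPs : ∀ K, P K → ContDiff ℝ ∞ K := by
    rintro K (rfl | rfl | ⟨i, rfl⟩ | ⟨i, rfl⟩)
    exacts [hs₀.1, hd₀.1, (hs i).1, (hd i).1]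
  have hJ : ∀ i, ContDiff ℝ ∞ (ContactSplitting.jacobi (s i) (d i)) := fun i =>
    ContactSplitting.contDiff_jacobi (hs i).1 (hd i).1
  have hH' : H = fun z => (s₀ z + d₀ z) + ∑ i, ContactSplitting.jacobi (s i) (d i) z := funext hH
  have hsum : ContDiff ℝ ∞ fun z => ∑ i, ContactSplitting.jacobi (s i) (d i) z :=
    ContDiff.sum fun i _ => hJ i
  have hHs : ContDiff ℝ ∞ H := hH' ▸ (hs₀.1.add hd₀.1).add hsum
  have hdiff : ∀ {K : ContactSplitting.Jet n → ℝ}, ContDiff ℝ ∞ K → Differentiable ℝ K :=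
    fun hK => hK.differentiable (by simp)
  -- `X_H` is linear in `H`, so it splits into the fields of `s₀` and `d₀`, realized by single
  -- flows, and those of the brackets, realized by commutators.
  have hR : ContactSplitting.Realizes P (ContactSplitting.contactField H) := by
    rw [hH', ContactSplitting.contactField_add (hdiff (hs₀.1.add hd₀.1)) (hdiff hsum),
      ContactSplitting.contactField_add (hdiff hs₀.1) (hdiff hd₀.1),
      ContactSplitting.contactField_sum _ fun i => hdiff (hJ i)]
    have hX := fun {K} (hK : ContDiff ℝ ∞ K) => ContactSplitting.contDiff_contactField (n := n) hK
    refine ContactSplitting.Realizes.add ((hX hs₀.1).add (hX hd₀.1))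
      (ContDiff.sum fun i _ => hX (hJ i)) (ContactSplitting.Realizes.add (hX hs₀.1) (hX hd₀.1)
        (ContactSplitting.realizes_contactField hs₀.1 (Or.inl rfl))
        (ContactSplitting.realizes_contactField hd₀.1 (Or.inr (Or.inl rfl)))) ?_
    exact ContactSplitting.Realizes.sum _ (fun i => hX (hJ i)) fun i =>
      ContactSplitting.realizes_jacobi (hs i).1 (hd i).1 (Or.inr (Or.inr (Or.inl ⟨i, rfl⟩)))
        (Or.inr (Or.inr (Or.inr ⟨i, rfl⟩)))
  obtain ⟨w, hw, hC⟩ := ContactSplitting.exists_splitting hPs hHs hR hU k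
  have hws : ContactSplitting.SmoothWord w := fun F hF => hPs _ (hw F hF)
  obtain ⟨V, hV, hUV, h₀, hh₀, hdef⟩ := ContactSplitting.exists_common_domain hws hHs hU
  refine ⟨w, hw, ⟨V, hV, hUV, h₀, hh₀, fun h hh => ⟨fun z hz => (hdef h hh z hz).1, ?_,
    fun z hz => (hdef h hh z hz).2, ?_⟩⟩, hC⟩
  · exact ContactSplitting.isContactomorphismOn_splittingMap hws hV
      fun z hz => (hdef h hh z hz).1
  · exact (ContactSplitting.contDiffOn_contactFlow hHs h).mono fun z hz => (hdef h hh z hz).2
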